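/- **Setting.** Let $\mathfrak C$ be a countable small category, identified with its set of morphisms, with domain and target maps $\mathfrak d,\mathfrak t$ onto the set of objects $\mathfrak C^0\subseteq\mathfrak C$ (objects are identity morphisms); $cd$ is defined iff $\mathfrak d(c)=\mathfrak t(d)$. Assume that $\mathfrak C$ is left cancellative ($cx=cy\Rightarrow x=y$) and finitely aligned (each $a\mathfrak C\cap b\mathfrak C$ is a finite union of sets $c\mathfrak C$). Let $\mathfrak C^*$ be the set of invertible elements, write $a\preceq b$ if $b\in a\mathfrak C$, $a\prec b$ if $b\mathfrak C\subsetneq a\mathfrak C$, and $a=^*b$ if $a\in b\,\mathfrak C^*$. Let $\mathfrak S\subseteq\mathfrak C$ and $\mathfrak S^\sharp=\mathfrak S\mathfrak C^*\cup\mathfrak C^*$. A path $s_1s_2\cdots$ is normal if for all $k$ and all $r\in\mathfrak S$, $r\preceq s_ks_{k+1}$ implies $r\preceq s_k$. Assume that $\mathfrak S$ is a Garside family: it is closed under right comultiples (if $r,s\in\mathfrak S$ and $r,s\preceq a$, then there is $t\in\mathfrak S$ with $r,s\preceq t\preceq a$), $\mathfrak S\cup\mathfrak C^*$ generates $\mathfrak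 C$, $\mathfrak S^\sharp$ is closed under right divisors, and every element of $\mathfrak C$ is the product of a normal path in $\mathfrak S^\sharp$. Assume moreover that $\mathfrak S\cap\mathfrak C^*=\emptyset$, that $\mathfrak S$ is $=^*$-transverse ($s=^*t$ implies $s=t$ for $s,t\in\mathfrak S$), and that $\mathfrak S$ is locally bounded (no infinite sequence $s_1\prec s_2\prec\cdots$ in $\mathfrak S$ with a common target). For $a\in\mathfrak C\setminus\mathfrak C^*$, $H(a)$ denotes the greatest left divisor of $a$ in $\mathfrak S$ with respect to $\preceq$. Let $I_l$ be the left inverse hull, i.e. the smallest set of partial bijections of $\mathfrak C$ that contains all $\mathfrak d(c)\mathfrak C\to c\mathfrak C$, $x\mapsto cx$, and is closed under composition and inverses. Let $\mathcal J$ be the semilattice (under intersection) of domains of elements of $I_l$. Let $\Omega$ be the set of non-zero multiplicative maps $\chi:\mathcal J\to\{0,1\}$ with $\chi(\emptyset)=0$ if $\emptyset\in\mathcal J$, such that $e=f_1\cup\dots\cup f_n$ in $\mathcal J$ and $\chi(e)=1$ imply $\chi(f_i)=1$ for some $i$, with the topology of pointwise convergence. $I_l$ acts partially on $\Omega$ by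 $s.\chi=\chi(s^{-1}\sqcup s)$ if $\chi(s^{-1}s)=1$. For an invariant subset $Y\subseteq\Omega$, the transformation groupoid $I_l\ltimes Y$ consists of the classes $[s,\chi]$ ($s\in I_l$, $\chi\in Y$, $\chi(s^{-1}s)=1$), where $[s,\chi]=[t,\chi]$ iff $se=te$ for some $e\in\mathcal J$ with $\chi(e)=1$; its source and range maps are $[s,\chi]\mapsto\chi$ and $[s,\chi]\mapsto s.\chi$, its product is $[s,t.\chi][t,\chi]=[st,\chi]$, and its topology has as basis the sets $\{[s,\chi]:\chi\in U,\ \chi(s^{-1}s)=1\}$ with $s\in I_l$ and $U\subseteq Y$ open. An étale groupoid is topologically free if for every open bisection $\gamma$ that contains no unit, the set of units $x$ such that $\gamma$ contains an element with source and range $x$ has empty interior. For $x\in\mathfrak C$ let $\chi_x(e)=1$ iff $x\mathfrak C\subseteq e$, and for an infinite path $w=s_1s_2\cdots$ let $\chi_w(e)=1$ iff $s_1\cdots s_n\in e$ for some $n$. Let $\mathfrak T\subseteq\mathfrak S$ and $\mathfrak D\subseteq\mathfrak C^0$. The pair $(\mathfrak T,\mathfrak D)$ is - *admissible* if for every $t\in\mathfrak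 T$, there is $t'\in\mathfrak T$ with $tt'$ normal, or $\mathfrak d(t)\in\mathfrak D$; - *$H$-invariant* if $H(ax)\in\mathfrak T$ for all $a\in\mathfrak C\setminus\mathfrak C^*$ and $x\in\mathfrak T\cup\mathfrak D$ with $\mathfrak d(a)=\mathfrak t(x)$; - *$\max_\preceq^\infty$-closed* if whenever a sequence $(t_i)$ in $\mathfrak T$ has a limit $s\in\mathfrak S$, then $s\in\mathfrak T\cup\mathfrak D$. Here $\lim_i t_i=s$ means that $s\preceq t_i$ for almost all $i$ and that every $r\in\mathfrak S\cup\mathfrak C^0$ with $r\preceq t_i$ for infinitely many $i$ satisfies $r\preceq s$. Let $X(\mathfrak T,\mathfrak D)\subseteq\Omega$ be the set of all $\chi_w$ for infinite normal words $w$ with letters in $\mathfrak T$, all $\chi_v$ for finite non-empty normal words $v$ with letters in $\mathfrak T$ and $\mathfrak d(v)\in\mathfrak D$, and all $\chi_{\mathfrak v}$ for $\mathfrak v\in\mathfrak D$. By a finite normal path we mean a normal path $a=a_1\cdots a_na_{n+1}$ with $n\ge0$, $a_1,\dots,a_n\in\mathfrak S$ and $a_{n+1}\in\mathfrak C^*$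 (if $a_{n+1}$ is an identity, this is just a possibly empty normal path $a_1\cdots a_n$ in $\mathfrak S$); its first letter is $a_1$, and $a$ also denotes the product. **Statement.** Let $(\mathfrak T_1,\mathfrak D_1)$ and $(\mathfrak T_2,\mathfrak D_2)$ be admissible, $H$-invariant, $\max_\preceq^\infty$-closed pairs with $\mathfrak T_1\subseteq\mathfrak T_2\subseteq\mathfrak S$ and $\mathfrak D_1\subseteq\mathfrak D_2\subseteq\mathfrak C^0$, where $\mathfrak D_1$ and $\mathfrak D_2$ are closed under isomorphism of objects (which is automatic if $\mathfrak C^*=\mathfrak C^0$). Set $X_j=X(\mathfrak T_j,\mathfrak D_j)$ for $j=1,2$. Assume that 1. for every $\mathfrak v\in\mathfrak D_2\setminus\mathfrak D_1$, the only invertible element with domain and target $\mathfrak v$ is the identity $\mathfrak v$; 2. for all finite normal paths $a,b$ with $\mathfrak t(a)=\mathfrak t(b)$, $\mathfrak d(a)=\mathfrak d(b)$ and $a_1\ne b_1$, and every $s\in\mathfrak T_2\setminus\mathfrak T_1$ with $\mathfrak d(s)=\mathfrak d(a)$, there exists $t\in\mathfrak T_2\setminus\mathfrak T_1$ such that $st$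 is normal and $H(at)\neq H(bt)$. Then $X_2\setminus X_1$ is an $I_l$-invariant subset of $\Omega$, and the groupoid $I_l\ltimes(X_2\setminus X_1)$ is topologically free. -/

import Mathlib

open CategoryTheory Topology

universe v u

namespace GarsideCat

/-! ### Small categories as sets of morphisms with a partial product -/

/-- The set of morphisms of a category. The domain is `dom`, the target is `cod`. -/
@[ext]
structure Mor (V : Type u) [Category.{v} V] where
  dom : V
  cod : V
  hom : dom ⟶ cod

namespace Mor

variable {V : Type u} [Category.{v} V]

/-- The object `x`, viewed as its identity morphism. -/
def one (x : V) : Mor V := ⟨x, x, 𝟙 x⟩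

/-- The product `c x` (first `x`, then `c`), defined when the domain of `c` is the target of `x`. -/
def mul (c x : Mor V) (h : c.dom = x.cod) : Mor V :=
  ⟨x.dom, c.cod, x.hom ≫ eqToHom h.symm ≫ c.hom⟩

/-- Membership in `C*`. -/
def IsInv (c : Mor V) : Prop := IsIso c.hom

/-- `a ≼ b`: `a` is a left divisor of `b`, i.e. `b ∈ a C`. -/
def LeftDvd (a b : Mor V) : Prop := ∃ (x : Mor V) (h : a.dom = x.cod), b = a.mul x h

/-- The principal right ideal `a C`. -/
def ideal (a : Mor V) : Set (Mor V) := {b | LeftDvd a b}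

/-- `a =* b`, i.e. `a ∈ b C*`. -/
def UnitEq (a b : Mor V) : Prop := ∃ (w : Mor V) (h : b.dom = w.cod), w.IsInv ∧ a = b.mul w h

end Mor

/-- A category is left cancellative if `c x = c y` implies `x = y`. -/
class LeftCancellative (V : Type u) [Category.{v} V] : Prop where
  cancel : ∀ (c x y : Mor V) (hx : c.dom = x.cod) (hy : c.dom = y.cod),
    c.mul x hx = c.mul y hy → x = y

/-- For all `a, b`, the set `a C ∩ b C` is a finite union of principal right ideals. -/
def FinitelyAligned (V : Type u) [Category.{v} V] : Prop :=
  ∀ a b : Mor V, ∃ F : Finset (Mor V), a.ideal ∩ b.ideal = ⋃ c ∈ F, c.ideal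

/-! ### Garside families -/

section Garside

variable {V : Type u} [Category.{v} V]

/-- `IsComp [s₁, …, sₙ] w x`: the sequence `s₁, …, sₙ, w` is a path with product `x`. -/
inductive IsComp : List (Mor V) → Mor V → Mor V → Prop
  | nil (w : Mor V) : IsComp [] w w
  | cons (s : Mor V) (l : List (Mor V)) (w x : Mor V) (h : s.dom = x.cod) :
      IsComp l w x → IsComp (s :: l) w (s.mul x h)

/-- `S♯ = S C* ∪ C*`. -/
def sharp (S : Set (Mor V)) : Set (Mor V) :=
  {x | (∃ s ∈ S, x.UnitEq s) ∨ x.IsInv}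

/-- The path `s t` of length two is `S`-normal. -/
def NormalPair (S : Set (Mor V)) (s t : Mor V) : Prop :=
  ∃ h : s.dom = t.cod, ∀ r ∈ S, r.LeftDvd (s.mul t h) → r.LeftDvd s

/-- `S` is a Garside family. -/
structure IsGarside (S : Set (Mor V)) : Prop where
  /-- `S` is closed under right comultiples. -/
  comultiple : ∀ r ∈ S, ∀ s ∈ S, ∀ a : Mor V, r.LeftDvd a → s.LeftDvd a →
    ∃ t ∈ S, r.LeftDvd t ∧ s.LeftDvd t ∧ t.LeftDvd a
  /-- `S ∪ C*` generates the category. -/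
  generates : ∀ a : Mor V, ∃ (l : List (Mor V)) (w : Mor V),
    (∀ s ∈ l ++ [w], s ∈ S ∨ s.IsInv) ∧ IsComp l w a
  /-- `S♯` is closed under right divisors. -/
  right_divisor : ∀ (a b : Mor V) (h : a.dom = b.cod), a.mul b h ∈ sharp S → b ∈ sharp S
  /-- Every element has an `S`-normal decomposition, with letters in `S♯`. -/
  normal : ∀ a : Mor V, ∃ (l : List (Mor V)) (w : Mor V),
    (∀ s ∈ l ++ [w], s ∈ sharp S) ∧ (l ++ [w]).IsChain (NormalPair S) ∧ IsComp l w a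

/-- `S` is `=*`-transverse. -/
def Transverse (S : Set (Mor V)) : Prop := ∀ s ∈ S, ∀ t ∈ S, s.UnitEq t → s = t

/-- There is no infinite sequence `s₁ ≺ s₂ ≺ ⋯` in `x S`, for any object `x`
(where `a ≺ b` means `b C ⊊ a C`). -/
def LocallyBounded (S : Set (Mor V)) : Prop :=
  ∀ x : V, ¬ ∃ s : ℕ → Mor V, (∀ n, s n ∈ S ∧ (s n).cod = x) ∧
    ∀ n, (s (n + 1)).ideal ⊂ (s n).ideal

/-- `s` is the `S`-head of `a`, i.e. `s = H(a)`. -/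
def IsHead (S : Set (Mor V)) (a s : Mor V) : Prop :=
  s ∈ S ∧ s.LeftDvd a ∧ ∀ r ∈ S, r.LeftDvd a → r.LeftDvd s

/-- `l` is a finite (possibly empty) normal word with letters in `S`. -/
def IsNormalWord (S : Set (Mor V)) (l : List (Mor V)) : Prop :=
  (∀ s ∈ l, s ∈ S) ∧ l.IsChain (NormalPair S)

/-- `s₁, …, sₙ, w` (with `l = [s₁, …, sₙ]`, where `n = 0` is allowed) is a finite normal path with
product `a` whose letters `s₁, …, sₙ` lie in `S` and whose last letter `w` is invertible. Its first
letter is `l.headD w`. -/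
def IsFiniteNormalPath (S : Set (Mor V)) (l : List (Mor V)) (w a : Mor V) : Prop :=
  IsNormalWord S l ∧ w.IsInv ∧ IsComp l w a

/-- `w 0, w 1, w 2, …` is an infinite normal word with letters in `S`. -/
def IsInfiniteNormalWord (S : Set (Mor V)) (w : ℕ → Mor V) : Prop :=
  ∀ n, w n ∈ S ∧ NormalPair S (w n) (w (n + 1))

/-! ### Pairs `(T, D)` -/

/-- For all `t ∈ T`, there is `t' ∈ T` such that `t t'` is normal, or the domain of `t` is in `D`. -/
def Admissible (S T : Set (Mor V)) (D : Set V) : Prop :=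
  ∀ t ∈ T, (∃ t' ∈ T, NormalPair S t t') ∨ t.dom ∈ D

/-- For all non-invertible `a` and all `x ∈ T ∪ D` such that `a x` is defined, `H(a x) ∈ T`. -/
def HInvariant (S T : Set (Mor V)) (D : Set V) : Prop :=
  ∀ a : Mor V, ¬ a.IsInv → ∀ x ∈ T ∪ Mor.one '' D, ∀ h : a.dom = x.cod,
    ∃ t ∈ T, IsHead S (a.mul x h) t

/-- `limᵢ t i = s`: `s ∈ S ∪ C⁰` divides almost all `t i`, and every element of `S ∪ C⁰` which
divides infinitely many `t i` divides `s`. -/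
def IsLim (S : Set (Mor V)) (t : ℕ → Mor V) (s : Mor V) : Prop :=
  s ∈ S ∪ Set.range Mor.one ∧ (∀ᶠ i in Filter.atTop, s.LeftDvd (t i)) ∧
    ∀ r ∈ S ∪ Set.range Mor.one, (∃ᶠ i in Filter.atTop, r.LeftDvd (t i)) → r.LeftDvd s

/-- If a sequence in `T` has a limit in `S`, then the limit lies in `T ∪ D`. -/
def MaxClosed (S T : Set (Mor V)) (D : Set V) : Prop :=
  ∀ t : ℕ → Mor V, (∀ i, t i ∈ T) → ∀ s ∈ S, IsLim S t s → s ∈ T ∪ Mor.one '' D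

/-- `D` is closed under isomorphism of objects. -/
def IsoClosed (D : Set V) : Prop := ∀ x ∈ D, ∀ y : V, Nonempty (x ≅ y) → y ∈ D

end Garside

/-! ### The left inverse hull, its idempotents and their characters -/

section Hull

variable {V : Type u} [Category.{v} V] [LeftCancellative V]

open Classical in
/-- The partial bijection `x ↦ c x` from `d(c) C` to `c C`. -/
noncomputable def leftMul (c : Mor V) : Mor V ≃. Mor V where
  toFun x := if h : c.dom = x.cod then some (c.mul x h) else none
  invFun y := if h : c.LeftDvd y then some h.choose else none
  inv x y := by
    constructor
    · intro hx
      by_cases hd : c.LeftDvd y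
      · rw [dif_pos hd] at hx
        obtain ⟨h, hy⟩ := hd.choose_spec
        cases hx
        rw [dif_pos h]
        exact congrArg some hy.symm
      · rw [dif_neg hd] at hx
        cases hx
    · intro hy
      by_cases h : c.dom = x.cod
      · rw [dif_pos h] at hy
        have hy : c.mul x h = y := Option.some.inj hy
        have hd : c.LeftDvd y := ⟨x, h, hy.symm⟩
        rw [dif_pos hd]
        obtain ⟨h', hy'⟩ := hd.choose_spec
        exact congrArg some (LeftCancellative.cancel c _ _ h' h (hy'.symm.trans hy.symm))
      · rw [dif_neg h] at hy
        cases hy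

/-- The smallest set of partial bijections of `C` which contains all `c ∈ C` and is closed under
composition and inverses. -/
inductive InHull : (Mor V ≃. Mor V) → Prop
  | gen (c : Mor V) : InHull (leftMul c)
  | comp (s t : Mor V ≃. Mor V) : InHull s → InHull t → InHull (t.trans s)
  | inv (s : Mor V ≃. Mor V) : InHull s → InHull s.symm

variable (V) in
/-- The left inverse hull `I_l`. -/
@[ext]
structure Hull where
  val : Mor V ≃. Mor V
  property : InHull val

variable (V) in
/-- The semilattice `J` of idempotents of `I_l`, realized as the domains of elements of `I_l`. -/
@[ext]
structure Idem where
  val : Set (Mor V)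
  property : ∃ s : Hull V, val = {x | ∃ y, y ∈ s.1 x}

namespace Hull

/-- The product `s t` in `I_l` (first `t`, then `s`). -/
def mul (s t : Hull V) : Hull V := ⟨t.1.trans s.1, InHull.comp _ _ s.2 t.2⟩

/-- The inverse in `I_l`. -/
def inv (s : Hull V) : Hull V := ⟨s.1.symm, InHull.inv _ s.2⟩

/-- The idempotent `s⁻¹ s`, i.e. the domain of `s`. -/
def supp (s : Hull V) : Idem V := ⟨{x | ∃ y, y ∈ s.1 x}, s, rfl⟩

/-- The idempotent `s⁻¹ e s`, i.e. the set of all `x` in the domain of `s` with `s(x) ∈ e`. -/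
def pull (s : Hull V) (e : Idem V) : Idem V :=
  ⟨{x | ∃ y, y ∈ s.1 x ∧ y ∈ e.1}, by
    obtain ⟨t, ht⟩ := e.2
    refine ⟨t.mul s, ?_⟩
    ext x
    simp only [ht, Set.mem_ofPred_eq, mul, PEquiv.mem_trans]
    constructor
    · rintro ⟨y, hy, z, hz⟩
      exact ⟨z, y, hy, hz⟩
    · rintro ⟨z, y, hy, hz⟩
      exact ⟨y, hy, z, hz⟩⟩

end Hull

/-- The product in `J`, i.e. the intersection. -/
def Idem.inter (e f : Idem V) : Idem V :=
  ⟨e.1 ∩ f.1, by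
    obtain ⟨s, hs⟩ := e.2
    obtain ⟨t, ht⟩ := f.2
    refine ⟨t.mul (s.inv.mul s), ?_⟩
    ext x
    simp only [hs, ht, Set.mem_inter_iff, Set.mem_ofPred_eq, Hull.mul, Hull.inv, PEquiv.mem_trans]
    constructor
    · rintro ⟨⟨y, hy⟩, z, hz⟩
      exact ⟨z, x, ⟨y, hy, (PEquiv.mem_iff_mem _).2 hy⟩, hz⟩
    · rintro ⟨z, x', ⟨y, hy, hy'⟩, hz⟩
      have : x' = x := Option.mem_unique hy' ((PEquiv.mem_iff_mem _).2 hy)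
      subst this
      exact ⟨⟨y, hy⟩, z, hz⟩⟩

/-- `χ` is a character of `J`: non-zero, multiplicative, and zero on the empty set. -/
structure IsCharacter (χ : Idem V → Bool) : Prop where
  nonzero : ∃ e, χ e = true
  mul : ∀ e f, χ (e.inter f) = (χ e && χ f)
  zero : ∀ e : Idem V, e.1 = ∅ → χ e = false

variable (V) in
/-- The space `Ω`: the characters `χ` such that `e = f₁ ∪ ⋯ ∪ fₙ` and `χ(e) = 1` imply
`χ(fᵢ) = 1` for some `i`. -/
@[ext]
structure Omega where
  val : Idem V → Bool
  property : IsCharacter val ∧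
    ∀ (e : Idem V) (F : Set (Idem V)), F.Finite → e.1 = ⋃ f ∈ F, f.1 → val e = true →
      ∃ f ∈ F, val f = true

/-- The topology of pointwise convergence. -/
instance : TopologicalSpace (Omega V) := TopologicalSpace.induced Omega.val inferInstance

theorem Omega.mono (χ : Omega V) {e f : Idem V} (h : e.1 ⊆ f.1) (he : χ.1 e = true) :
    χ.1 f = true := by
  have h1 := χ.2.1.mul e f
  have h2 : e.inter f = e := Idem.ext (Set.inter_eq_left.2 h)
  rw [h2, he] at h1
  simpa using h1.symm

/-- The action `s.χ = χ(s⁻¹ ⬝ s)`, defined when `χ(s⁻¹ s) = 1`. -/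
def act (s : Hull V) (χ : Omega V) (h : χ.1 s.supp = true) : Omega V :=
  ⟨fun e => χ.1 (s.pull e), by
    refine ⟨⟨⟨s.inv.supp, χ.mono ?_ h⟩, ?_, ?_⟩, ?_⟩
    · rintro x ⟨y, hy⟩
      exact ⟨y, hy, x, (PEquiv.mem_iff_mem _).2 hy⟩
    · intro e f
      have : s.pull (e.inter f) = (s.pull e).inter (s.pull f) := by
        apply Idem.ext
        ext x
        constructor
        · rintro ⟨y, hy, he, hf⟩
          exact ⟨⟨y, hy, he⟩, y, hy, hf⟩
        · rintro ⟨⟨y, hy, he⟩, z, hz, hf⟩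
          have : y = z := Option.mem_unique hy hz
          subst this
          exact ⟨y, hy, he, hf⟩
      rw [this]
      exact χ.2.1.mul _ _
    · intro e he
      apply χ.2.1.zero
      ext x
      simp [Hull.pull, he]
    · intro e F hF he h1
      obtain ⟨f, ⟨g, hg, rfl⟩, hf⟩ := χ.2.2 (s.pull e) (s.pull '' F) (hF.image _) (by
        ext x
        simp only [Hull.pull, he, Set.mem_iUnion, Set.mem_ofPred_eq, Set.mem_image, exists_prop]
        constructor
        · rintro ⟨y, hy, f, hf, hyf⟩
          exact ⟨_, ⟨f, hf, rfl⟩, y, hy, hyf⟩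
        · rintro ⟨_, ⟨f, hf, rfl⟩, y, hy, hyf⟩
          exact ⟨y, hy, f, hf, hyf⟩) h1
      exact ⟨g, hg, hf⟩⟩

/-- `Y` is invariant under the action of `I_l` on `Ω`. -/
def Invariant (Y : Set (Omega V)) : Prop :=
  ∀ χ ∈ Y, ∀ (s : Hull V) (h : χ.1 s.supp = true), act s χ h ∈ Y

/-! ### The characters of words, and the sets `X(T, D)` -/

/-- `χ = χ_x`, i.e. `χ(e) = 1` if and only if `x C ⊆ e`. -/
def IsCharOf (χ : Omega V) (x : Mor V) : Prop :=
  ∀ e : Idem V, χ.1 e = true ↔ x.ideal ⊆ e.1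

/-- `χ = χ_w` for the infinite path `w`, i.e. `χ(e) = 1` if and only if some finite initial
product `w 0 w 1 ⋯ w n` lies in `e`. -/
def IsCharOfInfinite (χ : Omega V) (w : ℕ → Mor V) : Prop :=
  ∀ e : Idem V, χ.1 e = true ↔
    ∃ (n : ℕ) (x : Mor V), IsComp ((List.range n).map w) (w n) x ∧ x ∈ e.1

/-- `X(T, D)`: all `χ_w` for infinite normal words `w` with letters in `T`, and all `χ_a` for finite
(possibly empty) normal words `a` with letters in `T` whose domain lies in `D`. The empty words give
the characters `χ_x` with `x ∈ D`. -/
def spaceOf (S T : Set (Mor V)) (D : Set V) : Set (Omega V) :=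
  {χ | (∃ w : ℕ → Mor V, IsInfiniteNormalWord S w ∧ (∀ n, w n ∈ T) ∧ IsCharOfInfinite χ w) ∨
    ∃ (l : List (Mor V)) (x : V) (a : Mor V), x ∈ D ∧ IsNormalWord S l ∧ (∀ t ∈ l, t ∈ T) ∧
      IsComp l (Mor.one x) a ∧ IsCharOf χ a}

/-! ### The transformation groupoid -/

/-- The unit space of `I_l ⋉ Y`. -/
@[ext]
structure UnitPt (Y : Set (Omega V)) where
  val : Omega V
  mem : val ∈ Y

instance (Y : Set (Omega V)) : TopologicalSpace (UnitPt Y) :=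
  TopologicalSpace.induced UnitPt.val inferInstance

/-- The elements `s ∈ I_l` such that `s.χ` is defined and equal to `ψ`. -/
@[ext]
structure PreHom {Y : Set (Omega V)} (χ ψ : UnitPt Y) where
  val : Hull V
  property : ∃ h : χ.val.1 val.supp = true, act val χ.val h = ψ.val

/-- `(s, χ) ∼ (t, χ)` if and only if `s e = t e` for some `e ∈ J` with `χ(e) = 1`. -/
instance germSetoid {Y : Set (Omega V)} (χ ψ : UnitPt Y) : Setoid (PreHom χ ψ) where
  r s t := ∃ e : Idem V, χ.val.1 e = true ∧ ∀ x ∈ e.1, s.1.1 x = t.1.1 x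
  iseqv := by
    refine ⟨fun s => ?_, ?_, ?_⟩
    · obtain ⟨e, he⟩ := χ.val.2.1.nonzero
      exact ⟨e, he, fun _ _ => rfl⟩
    · rintro s t ⟨e, he, h⟩
      exact ⟨e, he, fun x hx => (h x hx).symm⟩
    · rintro s t r ⟨e, he, h⟩ ⟨f, hf, h'⟩
      refine ⟨e.inter f, ?_, fun x hx => (h x hx.1).trans (h' x hx.2)⟩
      rw [χ.val.2.1.mul, he, hf]
      rfl

/-- The elements `[s, χ]` of `I_l ⋉ Y` with source `χ` and range `s.χ = ψ`. -/
def Germ {Y : Set (Omega V)} (χ ψ : UnitPt Y) := Quotient (germSetoid χ ψ)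

theorem pull_mul (s t : Hull V) (e : Idem V) : (s.mul t).pull e = t.pull (s.pull e) := by
  apply Idem.ext
  ext x
  simp only [Hull.pull, Hull.mul, PEquiv.mem_trans, Set.mem_ofPred_eq]
  constructor
  · rintro ⟨z, ⟨y, hy, hz⟩, he⟩
    exact ⟨y, hy, z, hz, he⟩
  · rintro ⟨y, hy, z, hz, he⟩
    exact ⟨z, ⟨y, hy, hz⟩, he⟩

theorem supp_mul (s t : Hull V) : (s.mul t).supp = t.pull s.supp := by
  apply Idem.ext
  ext x
  simp only [Hull.pull, Hull.supp, Hull.mul, PEquiv.mem_trans, Set.mem_ofPred_eq]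
  constructor
  · rintro ⟨z, y, hy, hz⟩
    exact ⟨y, hy, z, hz⟩
  · rintro ⟨y, hy, z, hz⟩
    exact ⟨z, y, hy, hz⟩

theorem supp_inv_mul_self (s : Hull V) : (s.inv.mul s).supp = s.supp := by
  rw [supp_mul]
  apply Idem.ext
  ext x
  constructor
  · rintro ⟨y, hy, -⟩
    exact ⟨y, hy⟩
  · rintro ⟨y, hy⟩
    exact ⟨y, hy, x, (PEquiv.mem_iff_mem _).2 hy⟩

theorem inv_mul_self_apply (s : Hull V) {x : Mor V} (hx : x ∈ s.supp.1) :
    (s.inv.mul s).1 x = some x := by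
  obtain ⟨y, hy⟩ := hx
  refine Option.mem_def.1 ((PEquiv.mem_trans _ _ _ _).2 ⟨y, hy, (PEquiv.mem_iff_mem _).2 hy⟩)

theorem act_inv_mul_self (s : Hull V) (χ : Omega V) (h : χ.1 s.supp = true)
    (h' : χ.1 (s.inv.mul s).supp = true) : act (s.inv.mul s) χ h' = χ := by
  apply Omega.ext
  funext e
  have : (s.inv.mul s).pull e = s.supp.inter e := by
    apply Idem.ext
    ext x
    constructor
    · rintro ⟨y, hy, he⟩
      have hx : x ∈ s.supp.1 := by
        rw [← supp_inv_mul_self]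
        exact ⟨y, hy⟩
      rw [inv_mul_self_apply s hx, Option.mem_some_iff] at hy
      exact ⟨hx, hy ▸ he⟩
    · rintro ⟨hx, he⟩
      exact ⟨x, by rw [inv_mul_self_apply s hx]; rfl, he⟩
  change χ.1 ((s.inv.mul s).pull e) = χ.1 e
  rw [this, χ.2.1.mul, h, Bool.true_and]

theorem exists_supp (χ : Omega V) : ∃ s : Hull V, χ.1 s.supp = true := by
  obtain ⟨e, he⟩ := χ.2.1.nonzero
  obtain ⟨s, hs⟩ := e.2
  exact ⟨s, χ.mono hs.subset he⟩

variable {Y : Set (Omega V)}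

/-- The unit at `χ`, i.e. `[s⁻¹ s, χ]` for any `s ∈ I_l` with `χ(s⁻¹ s) = 1`. -/
noncomputable def Germ.id (χ : UnitPt Y) : Germ χ χ :=
  Quotient.mk _ ⟨(exists_supp χ.val).choose.inv.mul (exists_supp χ.val).choose, by
    have h := (exists_supp χ.val).choose_spec
    have h' := h
    rw [← supp_inv_mul_self] at h'
    exact ⟨h', act_inv_mul_self _ _ h h'⟩⟩

/-- Composition at the level of representatives. -/
def PreHom.comp {χ ψ ω : UnitPt Y} (t : PreHom χ ψ) (s : PreHom ψ ω) : PreHom χ ω :=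
  ⟨s.1.mul t.1, by
    obtain ⟨t, ht, ht'⟩ := t
    obtain ⟨s, hs, hs'⟩ := s
    have h : χ.val.1 (s.mul t).supp = true := by
      rw [supp_mul]
      rw [← ht'] at hs
      exact hs
    refine ⟨h, ?_⟩
    refine Eq.trans ?_ hs'
    apply Omega.ext
    funext e
    change χ.val.1 ((s.mul t).pull e) = ψ.val.1 (s.pull e)
    rw [pull_mul, ← ht']
    rfl⟩

/-- Inversion at the level of representatives. -/
def PreHom.inv {χ ψ : UnitPt Y} (s : PreHom χ ψ) : PreHom ψ χ :=
  ⟨s.1.inv, by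
    obtain ⟨s, hs, hs'⟩ := s
    have h : ψ.val.1 s.inv.supp = true := by
      rw [← hs']
      change χ.val.1 (s.pull s.inv.supp) = true
      rw [← supp_mul, supp_inv_mul_self]
      exact hs
    have h' := hs
    rw [← supp_inv_mul_self] at h'
    refine ⟨h, ?_⟩
    refine Eq.trans ?_ (act_inv_mul_self s χ.val hs h')
    apply Omega.ext
    funext e
    change ψ.val.1 (s.inv.pull e) = χ.val.1 ((s.inv.mul s).pull e)
    rw [pull_mul, ← hs']
    rfl⟩

/-- `[s, t.χ] [t, χ] = [s t, χ]`. -/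
def Germ.comp {χ ψ ω : UnitPt Y} (g : Germ χ ψ) (k : Germ ψ ω) : Germ χ ω :=
  Quotient.map₂ PreHom.comp (by
    rintro t t' ⟨e, he, h⟩ s s' ⟨f, hf, h'⟩
    refine ⟨(t.1.pull f).inter e, ?_, ?_⟩
    · obtain ⟨t, ht, ht'⟩ := t
      rw [χ.val.2.1.mul, he, Bool.and_true]
      rw [← ht'] at hf
      exact hf
    · rintro x ⟨⟨y, hy, hyf⟩, hxe⟩
      have hy' : y ∈ t'.1.1 x := by rw [← h x hxe]; exact hy
      change (t.1.1 x).bind s.1.1 = (t'.1.1 x).bind s'.1.1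
      rw [Option.mem_def.1 hy, Option.mem_def.1 hy']
      exact h' y hyf) g k

/-- `[s, χ]⁻¹ = [s⁻¹, s.χ]`. -/
def Germ.inv {χ ψ : UnitPt Y} (g : Germ χ ψ) : Germ ψ χ :=
  Quotient.map PreHom.inv (by
    rintro s s' ⟨e, he, h⟩
    obtain ⟨hs, hs'⟩ := s.2
    have key : ∀ x ∈ e.1, ∀ y, y ∈ s.1.1 x → s.1.inv.1 y = s'.1.inv.1 y := by
      intro x hx y hy
      have hy' : y ∈ s'.1.1 x := by rw [← h x hx]; exact hy
      have h1 : x ∈ s.1.inv.1 y := (PEquiv.mem_iff_mem _).2 hy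
      have h2 : x ∈ s'.1.inv.1 y := (PEquiv.mem_iff_mem _).2 hy'
      rw [Option.mem_def.1 h1, Option.mem_def.1 h2]
    refine ⟨s.1.inv.pull e, ?_, ?_⟩
    · rw [← hs']
      change χ.val.1 (s.1.pull (s.1.inv.pull e)) = true
      rw [← pull_mul]
      have h' := hs
      rw [← supp_inv_mul_self] at h'
      have := congrArg (fun ψ => ψ.1 e) (act_inv_mul_self s.1 χ.val hs h')
      exact this.trans he
    · rintro y ⟨x, hx, hxe⟩
      exact key x hxe y ((PEquiv.mem_iff_mem _).1 hx)) g

/-- The transformation groupoid `I_l ⋉ Y`, with unit space `Y`. If `Y` is not invariant, this is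
the restriction of `I_l ⋉ Ω` to `Y`. -/
noncomputable instance transformationGroupoid : Groupoid (UnitPt Y) where
  Hom χ ψ := Germ χ ψ
  id χ := Germ.id χ
  comp g k := Germ.comp g k
  inv g := Germ.inv g
  id_comp := by
    rintro χ ψ ⟨s⟩
    refine Quotient.sound ⟨(exists_supp χ.val).choose.supp, (exists_supp χ.val).choose_spec, ?_⟩
    intro x hx
    change ((Hull.mul _ _).1 x).bind s.1.1 = s.1.1 x
    rw [inv_mul_self_apply _ hx]
    rfl
  comp_id := by
    rintro χ ψ ⟨s⟩
    refine Quotient.sound ⟨s.1.pull (exists_supp ψ.val).choose.supp, ?_, ?_⟩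
    · have h := (exists_supp ψ.val).choose_spec
      obtain ⟨hs, hs'⟩ := s.2
      exact (congrArg (fun φ : Omega V => φ.1 (exists_supp ψ.val).choose.supp) hs').trans h
    · rintro x ⟨y, hy, hy'⟩
      change (s.1.1 x).bind (Hull.mul _ _).1 = s.1.1 x
      rw [Option.mem_def.1 hy]
      exact inv_mul_self_apply _ hy'
  assoc := by
    rintro χ ψ ω ξ ⟨s⟩ ⟨t⟩ ⟨r⟩
    refine congrArg (Quotient.mk _) (PreHom.ext (Hull.ext ?_))
    exact (PEquiv.trans_assoc _ _ _)
  inv_comp := by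
    rintro χ ψ ⟨s⟩
    refine Quotient.sound ⟨(exists_supp ψ.val).choose.supp.inter s.1.inv.supp, ?_, ?_⟩
    · rw [ψ.val.2.1.mul, (exists_supp ψ.val).choose_spec, Bool.true_and]
      exact (PreHom.inv s).2.choose
    · rintro x ⟨hx, hx'⟩
      exact (inv_mul_self_apply s.1.inv hx').trans (inv_mul_self_apply _ hx).symm
  comp_inv := by
    rintro χ ψ ⟨s⟩
    refine Quotient.sound ⟨(exists_supp χ.val).choose.supp.inter s.1.supp, ?_, ?_⟩
    · rw [χ.val.2.1.mul, (exists_supp χ.val).choose_spec, Bool.true_and]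
      exact s.2.choose
    · rintro x ⟨hx, hx'⟩
      exact (inv_mul_self_apply s.1 hx').trans (inv_mul_self_apply _ hx).symm

/-- The set `[s, U]` of all `[s, χ] ∈ I_l ⋉ Y` with `χ ∈ U`. -/
def germSet (s : Hull V) (U : Set (UnitPt Y)) : Set (Mor (UnitPt Y)) :=
  {g | g.dom ∈ U ∧ ∃ h : ∃ h : g.dom.val.1 s.supp = true, act s g.dom.val h = g.cod.val,
    g.hom = (Quotient.mk _ ⟨s, h⟩ : Germ g.dom g.cod)}

/-- The topology of `I_l ⋉ Y`, with basis the sets `[s, U]` for `s ∈ I_l` and `U ⊆ Y` open. -/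
instance : TopologicalSpace (Mor (UnitPt Y)) :=
  TopologicalSpace.generateFrom {O | ∃ (s : Hull V) (U : Set (UnitPt Y)), IsOpen U ∧
    O = germSet s U}

end Hull

/-- An étale groupoid with unit space `X` is topologically free if for every open bisection `γ`
which contains no unit, the set of all units `x` such that `γ` contains an element with source and
range `x` has empty interior. -/
def TopologicallyFree (X : Type u) [Groupoid.{v} X] [TopologicalSpace X]
    [TopologicalSpace (Mor X)] : Prop :=
  ∀ γ : Set (Mor X), IsOpen γ → Set.InjOn Mor.dom γ → Set.InjOn Mor.cod γ →
    (∀ x : X, Mor.one x ∉ γ) → interior {x : X | ∃ g ∈ γ, g.dom = x ∧ g.cod = x} = ∅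

end GarsideCat

/-!
The action of `s ∈ I_l` on characters is transparent: elements of `I_l` commute with right
multiplication, so `s` sends the character of `x w₀ w₁ ⋯` to that of `s(x) w₀ w₁ ⋯` as soon as `x`
lies in the domain of `s` (`isCharOfRun_act`, `isCharOf_act`).

The computations with normal words rest on the fact that an element of `S` which divides `x b`
divides `x H(b)` (`IsHead.leftDvd_mul`). It gives normal forms of all elements
(`exists_isFiniteNormalPath`) and of `c w` for infinite normal words `w`
(`exists_infinite_normalForm`); by `H`-invariance the letters of the latter lie in `T` if those of
`w` do. Hence `X(T, D)` is invariant (`invariant_spaceOf`), and so is `X(T₂, D₂) \ X(T₁, D₁)`.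

For topological freeness, an element of an open bisection is locally of the form `[s, U]`, so it
suffices to show the following (`topologicallyFree_of_forall_exists`): if `s` fixes all points of an
open set `U` and `χ ∈ U`, then `s` is the identity on some `e ∈ J` with `χ(e) = 1`.
* If `χ = χ_a`, then `s(a) = a u` with `u` invertible. The domain of `a` is not in `D₁`, as
  otherwise `χ ∈ X(T₁, D₁)`, so `u` is an identity by the assumption on loops
  (`exists_identity_of_isCharOf`).
* If `χ = χ_w` with `w` infinite, then from some letter on all letters of `w` are outside `T₁`. Let
  `p` be a long initial piece of `w` and `q = s(p)`. If `p ≠ q`, split off the common prefix of the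
  normal forms, `p = r a` and `q = r b`. By the separation assumption `p` is continued to an
  infinite normal word `p t₀ t₁ ⋯` with `tᵢ ∈ T₂ \ T₁` and `H(a t₀) ≠ H(b t₀)`
  (`SeparatesPaths.exists_infinite`). Its character lies in `U`, because elements of `J` are finite
  unions of principal ideals and cannot distinguish words with a long common initial piece
  (`exists_forall_eq_of_agree`). As `s` fixes it, `a t₀ t₁ ⋯` and `b t₀ t₁ ⋯` have the same
  head, which is a contradiction (`exists_identity_of_infinite`).
-/

namespace GarsideCat

/-! ### The product of morphisms and left divisibility -/

section Product

variable {V : Type u} [Category.{v} V]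

namespace Mor

open Classical in
/-- The product as a total operation, with the value `a` where `a b` is not defined. With this
choice `a` is always a left divisor of `a * b`. -/
noncomputable instance : Mul (Mor V) := ⟨fun a b => if h : a.dom = b.cod then a.mul b h else a⟩

theorem mul_eq (a b : Mor V) (h : a.dom = b.cod) : a.mul b h = a * b := (dif_pos h).symm

theorem mul_of_ne (a b : Mor V) (h : a.dom ≠ b.cod) : a * b = a := dif_neg h

@[simp] theorem dom_one (x : V) : (one x).dom = x := rfl

@[simp] theorem cod_one (x : V) : (one x).cod = x := rfl

@[simp] theorem cod_mul (a b : Mor V) : (a * b).cod = a.cod := by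
  by_cases h : a.dom = b.cod
  · rw [← mul_eq a b h]; rfl
  · rw [mul_of_ne a b h]

theorem dom_mul {a b : Mor V} (h : a.dom = b.cod) : (a * b).dom = b.dom := by
  rw [← mul_eq a b h]; rfl

theorem comp_assoc {a b c : Mor V} (h : a.dom = b.cod) (h' : b.dom = c.cod) :
    a * b * c = a * (b * c) := by
  have h1 : (a.mul b h).dom = c.cod := h'
  have h2 : a.dom = (b.mul c h').cod := h
  rw [← mul_eq a b h, ← mul_eq b c h', ← mul_eq _ c h1, ← mul_eq a _ h2]
  simp [mul]

@[simp] theorem comp_one (a : Mor V) : a * one a.dom = a := by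
  rw [← mul_eq a (one a.dom) rfl]
  simp [mul, one]

@[simp] theorem one_comp (a : Mor V) : one a.cod * a = a := by
  rw [← mul_eq (one a.cod) a rfl]
  simp [mul, one]

theorem leftDvd_iff {a b : Mor V} : a.LeftDvd b ↔ ∃ x : Mor V, a.dom = x.cod ∧ b = a * x := by
  constructor
  · rintro ⟨x, h, rfl⟩
    exact ⟨x, h, mul_eq a x h⟩
  · rintro ⟨x, h, rfl⟩
    exact ⟨x, h, (mul_eq a x h).symm⟩

theorem leftDvd_mul_right (a b : Mor V) : a.LeftDvd (a * b) := by
  rw [leftDvd_iff]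
  by_cases h : a.dom = b.cod
  · exact ⟨b, h, rfl⟩
  · exact ⟨one a.dom, rfl, by rw [mul_of_ne a b h, comp_one]⟩

theorem LeftDvd.refl (a : Mor V) : a.LeftDvd a := by
  simpa using leftDvd_mul_right a (one a.dom)

theorem LeftDvd.cod_eq {a b : Mor V} (h : a.LeftDvd b) : a.cod = b.cod := by
  obtain ⟨x, -, rfl⟩ := leftDvd_iff.1 h
  simp

theorem LeftDvd.trans {a b c : Mor V} (h : a.LeftDvd b) (h' : b.LeftDvd c) : a.LeftDvd c := by
  obtain ⟨x, hx, rfl⟩ := leftDvd_iff.1 h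
  obtain ⟨y, hy, rfl⟩ := leftDvd_iff.1 h'
  rw [dom_mul hx] at hy
  rw [comp_assoc hx hy]
  exact leftDvd_mul_right _ _

theorem LeftDvd.mul_left {a b : Mor V} (h : a.LeftDvd b) {c : Mor V} (hc : c.dom = a.cod) :
    (c * a).LeftDvd (c * b) := by
  obtain ⟨x, hx, rfl⟩ := leftDvd_iff.1 h
  rw [← comp_assoc hc hx]
  exact leftDvd_mul_right _ _

theorem ideal_subset_iff {a b : Mor V} : a.ideal ⊆ b.ideal ↔ b.LeftDvd a :=
  ⟨fun h => h (LeftDvd.refl a), fun h _ hx => h.trans hx⟩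

theorem isInv_one (x : V) : (one x).IsInv := by
  unfold IsInv one
  infer_instance

theorem IsInv.mul {a b : Mor V} (ha : a.IsInv) (hb : b.IsInv) : (a * b).IsInv := by
  by_cases h : a.dom = b.cod
  · rw [← mul_eq a b h]
    unfold IsInv at *
    simp only [Mor.mul]
    infer_instance
  · rwa [mul_of_ne a b h]

theorem IsInv.exists_inv {a : Mor V} (ha : a.IsInv) :
    ∃ b : Mor V, b.IsInv ∧ a.dom = b.cod ∧ b.dom = a.cod ∧ a * b = one a.cod ∧
      b * a = one a.dom := by
  unfold IsInv at ha
  refine ⟨⟨a.cod, a.dom, inv a.hom⟩, ?_, rfl, rfl, ?_, ?_⟩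
  · unfold IsInv
    infer_instance
  · rw [← mul_eq a _ rfl]
    simp [Mor.mul, one]
  · rw [← mul_eq _ a rfl]
    simp [Mor.mul, one]

theorem IsInv.leftDvd {a : Mor V} (ha : a.IsInv) {b : Mor V} (h : a.cod = b.cod) :
    a.LeftDvd b := by
  obtain ⟨c, -, hac, hca, h1, -⟩ := ha.exists_inv
  have : b = a * (c * b) := by
    rw [← comp_assoc hac (hca.trans h), h1, h, one_comp]
  rw [this]
  exact leftDvd_mul_right _ _

theorem LeftDvd.mul_isInv {a b u : Mor V} (h : a.LeftDvd b) (hu : u.IsInv) :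
    (a * u).LeftDvd b := by
  by_cases hau : a.dom = u.cod
  · obtain ⟨x, hx, rfl⟩ := leftDvd_iff.1 h
    exact (hu.leftDvd (hau.symm.trans hx)).mul_left hau
  · rwa [mul_of_ne a u hau]

theorem leftDvd_mul_isInv_iff {a b u : Mor V} (hu : u.IsInv) :
    a.LeftDvd (b * u) ↔ a.LeftDvd b :=
  ⟨fun h => h.trans ((LeftDvd.refl b).mul_isInv hu), fun h => h.trans (leftDvd_mul_right _ _)⟩

theorem unitEq_iff {a b : Mor V} :
    a.UnitEq b ↔ ∃ w : Mor V, b.dom = w.cod ∧ w.IsInv ∧ a = b * w := by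
  constructor
  · rintro ⟨w, h, hw, rfl⟩
    exact ⟨w, h, hw, mul_eq _ _ h⟩
  · rintro ⟨w, h, hw, rfl⟩
    exact ⟨w, h, hw, (mul_eq _ _ h).symm⟩

variable [LeftCancellative V]

theorem comp_cancel {c x y : Mor V} (hx : c.dom = x.cod) (hy : c.dom = y.cod)
    (h : c * x = c * y) : x = y :=
  LeftCancellative.cancel c x y hx hy (by rwa [mul_eq, mul_eq])

theorem LeftDvd.of_mul_left {c a b : Mor V} (ha : c.dom = a.cod) (hb : c.dom = b.cod)
    (h : (c * a).LeftDvd (c * b)) : a.LeftDvd b := by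
  obtain ⟨x, hx, h⟩ := leftDvd_iff.1 h
  rw [dom_mul ha] at hx
  rw [comp_assoc ha hx] at h
  rw [comp_cancel hb (by simpa using ha) h]
  exact leftDvd_mul_right _ _

/-- By left cancellation, a one-sided inverse is two-sided. -/
theorem isInv_of_mul_eq_one {a b : Mor V} (h : a.dom = b.cod) (h1 : a * b = one a.cod) :
    a.IsInv ∧ b.IsInv := by
  have hd : b.dom = a.cod := by rw [← dom_mul h, h1]; rfl
  have h2 : b * a = one a.dom := by
    refine comp_cancel (c := a) (by simpa using h) rfl ?_
    rw [← comp_assoc h hd, h1, one_comp, comp_one]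
  obtain ⟨x, y, f⟩ := a
  obtain ⟨x', y', g⟩ := b
  dsimp only at h hd
  subst h hd
  rw [← mul_eq _ _ rfl] at h1 h2
  simp only [Mor.mul, one, Mor.mk.injEq, heq_eq_eq, true_and, eqToHom_refl, Category.id_comp]
    at h1 h2
  exact ⟨⟨g, h2, h1⟩, ⟨f, h1, h2⟩⟩

theorem IsInv.of_leftDvd {a b : Mor V} (hb : b.IsInv) (h : a.LeftDvd b) : a.IsInv := by
  obtain ⟨x, hx, rfl⟩ := leftDvd_iff.1 h
  obtain ⟨c, -, hc, -, h1, -⟩ := hb.exists_inv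
  rw [dom_mul hx] at hc
  rw [comp_assoc hx hc, cod_mul] at h1
  exact (isInv_of_mul_eq_one (by simpa using hx) h1).1

theorem IsInv.of_mul_right {a b : Mor V} (hab : (a * b).IsInv) (h : a.dom = b.cod) :
    b.IsInv := by
  obtain ⟨c, hc', hc, hc2, h1, -⟩ := (hab.of_leftDvd (leftDvd_mul_right a b)).exists_inv
  have : b = c * (a * b) := by
    obtain ⟨d, -, -, -, -, h2⟩ := (hab.of_leftDvd (leftDvd_mul_right a b)).exists_inv
    refine comp_cancel (c := a) h (by simpa using hc) ?_
    rw [← comp_assoc hc (by simpa using hc2), h1]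
    conv_rhs => rw [← cod_mul a b, one_comp]
  rw [this]
  exact hc'.mul hab

theorem isInv_of_mul_leftDvd {a b : Mor V} (h : a.dom = b.cod) (h' : (a * b).LeftDvd a) :
    b.IsInv := by
  have h2 : b.LeftDvd (one a.dom) := LeftDvd.of_mul_left h rfl (by rwa [comp_one])
  exact (isInv_one _).of_leftDvd h2

theorem LeftDvd.antisymm {a b : Mor V} (h : a.LeftDvd b) (h' : b.LeftDvd a) : a.UnitEq b := by
  obtain ⟨x, hx, rfl⟩ := leftDvd_iff.1 h
  obtain ⟨y, hy, h2⟩ := leftDvd_iff.1 h'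
  refine unitEq_iff.2 ⟨y, hy, ?_, h2⟩
  rw [dom_mul hx] at hy
  refine (isInv_of_mul_eq_one hy (comp_cancel (c := a) (by simpa using hx) hx ?_)).2
  rw [← comp_assoc hx hy, ← h2]
  conv_lhs => rw [← comp_one a, hx]

end Mor

end Product

/-! ### Heads -/

section Heads

open Mor

variable {V : Type u} [Category.{v} V] {S : Set (Mor V)}

theorem NormalPair.dom_eq {s t : Mor V} (h : NormalPair S s t) : s.dom = t.cod := h.1

theorem normalPair_iff {s t : Mor V} :
    NormalPair S s t ↔ s.dom = t.cod ∧ ∀ r ∈ S, r.LeftDvd (s * t) → r.LeftDvd s := by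
  constructor
  · rintro ⟨h, h'⟩
    rw [mul_eq] at h'
    exact ⟨h, h'⟩
  · rintro ⟨h, h'⟩
    rw [← mul_eq _ _ h] at h'
    exact ⟨h, h'⟩

theorem NormalPair.isHead {s t : Mor V} (hs : s ∈ S) (h : NormalPair S s t) :
    IsHead S (s * t) s :=
  ⟨hs, leftDvd_mul_right _ _, (normalPair_iff.1 h).2⟩

theorem isHead_self {s : Mor V} (hs : s ∈ S) : IsHead S s s :=
  ⟨hs, LeftDvd.refl s, fun _ _ h => h⟩

theorem IsHead.unique [LeftCancellative V] (hStrans : Transverse S) {a s t : Mor V}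
    (hs : IsHead S a s) (ht : IsHead S a t) : s = t :=
  hStrans s hs.1 t ht.1 (LeftDvd.antisymm (ht.2.2 s hs.1 hs.2.1) (hs.2.2 t ht.1 ht.2.1))

theorem IsHead.of_leftDvd {a b s : Mor V} (h : IsHead S b s) (hs : s.LeftDvd a)
    (hab : a.LeftDvd b) : IsHead S a s :=
  ⟨h.1, hs, fun r hr hra => h.2.2 r hr (hra.trans hab)⟩

theorem IsComp.cod_eq {l : List (Mor V)} {w a : Mor V} (h : IsComp l w a) :
    a.cod = (l.headD w).cod := by
  cases h <;> rfl

theorem IsComp.dom_eq {l : List (Mor V)} {w a : Mor V} (h : IsComp l w a) : a.dom = w.dom := by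
  induction h with
  | nil => rfl
  | cons s l w x h _ ih => exact ih

/-- `IsProd S n a`: the element `a` is a product of `n` factors from `S ∪ C*` and an invertible
element. -/
inductive IsProd (S : Set (Mor V)) : ℕ → Mor V → Prop
  | zero (u : Mor V) : u.IsInv → IsProd S 0 u
  | succ (n : ℕ) (s a : Mor V) : s ∈ S ∨ s.IsInv → s.dom = a.cod → IsProd S n a →
      IsProd S (n + 1) (s * a)

theorem IsGarside.exists_isProd (hS : IsGarside S) (a : Mor V) : ∃ n, IsProd S n a := by
  obtain ⟨l, w, hl, h⟩ := hS.generates a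
  induction h with
  | nil w =>
    refine ⟨1, ?_⟩
    rw [← comp_one w]
    exact .succ _ _ _ (hl w (by simp)) rfl (.zero _ (isInv_one _))
  | cons s l w x h _ ih =>
    obtain ⟨n, hn⟩ := ih fun s hs => hl s (by simp at hs ⊢; tauto)
    rw [mul_eq]
    exact ⟨n + 1, .succ _ _ _ (hl s (by simp)) h hn⟩

theorem mem_sharp_of_mul {a b : Mor V} (hS : IsGarside S) (h : a.dom = b.cod)
    (hab : a * b ∈ S ∨ (a * b).IsInv) : b ∈ sharp S := by
  refine hS.right_divisor a b h ?_
  rw [mul_eq]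
  refine hab.imp_left fun hab => ⟨_, hab, unitEq_iff.2 ⟨one (a * b).dom, rfl, isInv_one _, ?_⟩⟩
  rw [comp_one]

/-- The factors of a product in `S ∪ C*` cannot all be invertible if the product is not, and the
first non-invertible one provides a divisor. -/
theorem exists_leftDvd_of_not_isInv [LeftCancellative V] (hS : IsGarside S) {a : Mor V}
    (ha : ¬ a.IsInv) :
    ∃ s ∈ S, s.LeftDvd a := by
  obtain ⟨n, hn⟩ := hS.exists_isProd a
  suffices ∀ u : Mor V, u.IsInv → u.dom = a.cod → ∃ s ∈ S, s.LeftDvd (u * a) by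
    simpa using this (one a.cod) (isInv_one _) rfl
  induction hn with
  | zero u hu => exact absurd hu ha
  | succ n s a hs hsa _ ih =>
    intro u hu hus
    rw [cod_mul] at hus
    by_cases hs' : s.IsInv
    · obtain ⟨t, ht, h⟩ := ih (fun h => ha (hs'.mul h)) (u * s) (hu.mul hs')
        ((dom_mul hus).trans hsa)
      exact ⟨t, ht, by rwa [← comp_assoc hus hsa]⟩
    · -- `u s` is a right divisor of `s = u⁻¹ (u s)`, hence lies in `S♯`
      obtain ⟨u', -, -, hu2, -, h4⟩ := hu.exists_inv
      have hu3 : u'.dom = (u * s).cod := by rw [hu2, cod_mul]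
      have h5 : u' * (u * s) = s := by
        rw [← comp_assoc hu2 hus, h4, hus, one_comp]
      have h6 : u * s ∈ sharp S := by
        refine mem_sharp_of_mul hS hu3 ?_
        rw [h5]
        exact hs
      obtain ⟨t, ht, h7⟩ | h6 := h6
      · refine ⟨t, ht, ?_⟩
        obtain ⟨w, -, -, h8⟩ := unitEq_iff.1 h7
        rw [← comp_assoc hus hsa, h8]
        exact (leftDvd_mul_right _ _).trans (leftDvd_mul_right _ _)
      · exact absurd (h6.of_mul_right hus) hs'

/-- The set of left divisors in `S` of a non-invertible element is directed, and by local
boundedness it has a maximal element, which is thus the greatest one. -/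
theorem exists_isHead [LeftCancellative V] (hS : IsGarside S) (hSbdd : LocallyBounded S)
    {a : Mor V} (ha : ¬ a.IsInv) : ∃ s, IsHead S a s := by
  by_contra hno
  have step : ∀ s : {s // s ∈ S ∧ s.LeftDvd a}, ∃ t : {s // s ∈ S ∧ s.LeftDvd a},
      t.1.ideal ⊂ s.1.ideal := by
    rintro ⟨s, hs, hsa⟩
    have : ∃ r ∈ S, r.LeftDvd a ∧ ¬ r.LeftDvd s := by
      by_contra! h
      exact hno ⟨s, hs, hsa, h⟩
    obtain ⟨r, hr, hra, hrs⟩ := this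
    obtain ⟨t, ht, hrt, hst, hta⟩ := hS.comultiple r hr s hs a hra hsa
    exact ⟨⟨t, ht, hta⟩, ideal_subset_iff.2 hst,
      fun h => hrs (hrt.trans (ideal_subset_iff.1 h))⟩
  choose f hf using step
  obtain ⟨s, hs, hsa⟩ := exists_leftDvd_of_not_isInv hS ha
  refine hSbdd a.cod ⟨fun n => (f^[n] ⟨s, hs, hsa⟩).1, fun n => ⟨(f^[n] ⟨s, hs, hsa⟩).2.1,
    (f^[n] ⟨s, hs, hsa⟩).2.2.cod_eq⟩, fun n => ?_⟩
  simp only [Function.iterate_succ_apply']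
  exact hf _

theorem IsHead.leftDvd_of_mem_sharp {b h y : Mor V} (hb : IsHead S b h) (hy : y ∈ sharp S)
    (hyb : y.LeftDvd b) : y.LeftDvd h := by
  obtain ⟨s, hs, hys⟩ | hy := hy
  · obtain ⟨w, -, hw, rfl⟩ := unitEq_iff.1 hys
    exact (hb.2.2 s hs ((leftDvd_mul_right _ _).trans hyb)).mul_isInv hw
  · exact hy.leftDvd (hyb.cod_eq.trans hb.2.1.cod_eq.symm)

/-- An element of `S` which divides `x b` already divides `x H(b)`. This is the property of
Garside families on which all computations with normal words rest. -/
theorem IsHead.leftDvd_mul [LeftCancellative V] (hS : IsGarside S) {b h : Mor V}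
    (hb : IsHead S b h) {x r : Mor V} (hx : x.dom = b.cod) (hr : r ∈ S)
    (hrx : r.LeftDvd (x * b)) : r.LeftDvd (x * h) := by
  have hhb := hb.2.1.cod_eq
  obtain ⟨n, hn⟩ := hS.exists_isProd x
  induction hn generalizing r with
  | zero u hu =>
    obtain ⟨u', -, hu1, hu2, h3, h4⟩ := hu.exists_inv
    have hru : r.cod = u.cod := by simpa using hrx.cod_eq
    have hr' : r = u * (u' * r) := by
      rw [← comp_assoc hu1 (hu2.trans hru.symm), h3, ← hru, one_comp]
    have h1 : u.dom = (u' * r).cod := by simpa using hu1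
    rw [hr'] at hrx ⊢
    refine LeftDvd.mul_left (hb.leftDvd_of_mem_sharp ?_ (hrx.of_mul_left h1 hx)) h1
    refine mem_sharp_of_mul hS h1 ?_
    rw [← hr']
    exact .inl hr
  | succ n s a hs hsa _ ih =>
    rw [dom_mul hsa] at hx
    rw [comp_assoc hsa hx] at hrx
    rw [comp_assoc hsa (hx.trans hhb.symm)]
    -- it suffices to find a right multiple `s y` of `r` with `y ∈ S♯` and `y ≼ a b`
    have key : ∃ y ∈ sharp S, s.dom = y.cod ∧ r.LeftDvd (s * y) ∧ y.LeftDvd (a * b) := by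
      have hsab : s.dom = (a * b).cod := by simpa using hsa
      obtain hs | hs := hs
      · obtain ⟨t, ht, hrt, hst, htb⟩ := hS.comultiple r hr s hs _ hrx (leftDvd_mul_right _ _)
        obtain ⟨y, hy, rfl⟩ := leftDvd_iff.1 hst
        exact ⟨y, mem_sharp_of_mul hS hy (.inl ht), hy, hrt, htb.of_mul_left hy hsab⟩
      · obtain ⟨u', -, hu1, hu2, h3, h4⟩ := hs.exists_inv
        have hru : r.cod = s.cod := by simpa using hrx.cod_eq
        have hr' : r = s * (u' * r) := by
          rw [← comp_assoc hu1 (hu2.trans hru.symm), h3, ← hru, one_comp]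
        have h1 : s.dom = (u' * r).cod := by simpa using hu1
        refine ⟨u' * r, mem_sharp_of_mul hS h1 (.inl (hr' ▸ hr)), h1, hr' ▸ LeftDvd.refl r, ?_⟩
        exact LeftDvd.of_mul_left h1 hsab (hr' ▸ hrx)
    obtain ⟨y, hy, hsy, hry, hyab⟩ := key
    refine hry.trans (LeftDvd.mul_left ?_ hsy)
    obtain ⟨t, ht, hyt⟩ | hy := hy
    · obtain ⟨w, -, hw, rfl⟩ := unitEq_iff.1 hyt
      exact (ih hx ht ((leftDvd_mul_right _ _).trans hyab)).mul_isInv hw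
    · exact hy.leftDvd (by simpa using hyab.cod_eq)

end Heads

/-! ### Normal words -/

section Words

open Mor

variable {V : Type u} [Category.{v} V] {S : Set (Mor V)}

theorem IsComp.unique {l : List (Mor V)} {w a b : Mor V} (ha : IsComp l w a)
    (hb : IsComp l w b) : a = b := by
  induction ha generalizing b with
  | nil w =>
    cases hb
    rfl
  | cons s l w x h _ ih =>
    cases hb with
    | cons _ _ _ y h' hy =>
      cases ih hy
      rfl

theorem IsComp.mul_last {l : List (Mor V)} {u a : Mor V} (ha : IsComp l u a) {v : Mor V}
    (hv : u.dom = v.cod) : IsComp l (u * v) (a * v) := by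
  induction ha with
  | nil w => exact .nil _
  | cons s l w x h hx ih =>
    have h' : s.dom = (x * v).cod := by simpa using h
    rw [mul_eq, comp_assoc h (hx.dom_eq.trans hv), ← mul_eq _ _ h']
    exact .cons _ _ _ _ _ (ih hv)

theorem IsComp.concat {l : List (Mor V)} {s a : Mor V} (ha : IsComp l s a) {t : Mor V}
    (ht : s.dom = t.cod) : IsComp (l ++ [s]) t (a * t) := by
  induction ha with
  | nil w =>
    rw [← mul_eq _ _ ht]
    exact .cons _ _ _ _ _ (.nil _)
  | cons s l w x h hx ih =>
    have h' : s.dom = (x * t).cod := by simpa using h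
    rw [mul_eq, comp_assoc h (hx.dom_eq.trans ht), ← mul_eq _ _ h']
    exact .cons _ _ _ _ _ (ih ht)

/-- The letters `w 0, w 1, …` form an infinite path. -/
def IsPath (w : ℕ → Mor V) : Prop := ∀ n, (w n).dom = (w (n + 1)).cod

/-- The product `y w₀ ⋯ wₙ₋₁`. -/
noncomputable def run (y : Mor V) (w : ℕ → Mor V) : ℕ → Mor V
  | 0 => y
  | n + 1 => run y w n * w n

theorem run_succ (y : Mor V) (w : ℕ → Mor V) (n : ℕ) : run y w (n + 1) = run y w n * w n := rfl

theorem run_add (y : Mor V) (w : ℕ → Mor V) (m n : ℕ) :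
    run y w (m + n) = run (run y w m) (fun k => w (m + k)) n := by
  induction n with
  | zero => rfl
  | succ n ih => rw [← add_assoc, run_succ, run_succ, ih]

theorem run_succ' (y : Mor V) (w : ℕ → Mor V) (n : ℕ) :
    run y w (n + 1) = run (y * w 0) (fun k => w (k + 1)) n := by
  rw [add_comm, run_add]
  simp only [add_comm 1]
  rfl

theorem run_congr (y : Mor V) {w w' : ℕ → Mor V} {n : ℕ} (h : ∀ k < n, w k = w' k) :
    run y w n = run y w' n := by
  induction n with
  | zero => rfl
  | succ n ih => rw [run_succ, run_succ, ih fun k hk => h k (by omega), h n (by omega)]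

@[simp] theorem cod_run (y : Mor V) (w : ℕ → Mor V) (n : ℕ) : (run y w n).cod = y.cod := by
  induction n with
  | zero => rfl
  | succ n ih => rw [run_succ, cod_mul, ih]

theorem dom_run {y : Mor V} {w : ℕ → Mor V} (hw : IsPath w) (hy : y.dom = (w 0).cod) (n : ℕ) :
    (run y w n).dom = (w n).cod := by
  induction n with
  | zero => exact hy
  | succ n ih => rw [run_succ, dom_mul ih, hw]

theorem mul_run {c y : Mor V} {w : ℕ → Mor V} (hw : IsPath w) (hy : y.dom = (w 0).cod)
    (hc : c.dom = y.cod) (n : ℕ) : c * run y w n = run (c * y) w n := by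
  induction n with
  | zero => rfl
  | succ n ih => rw [run_succ, run_succ, ← ih, comp_assoc (by simpa using hc) (dom_run hw hy n)]

theorem run_leftDvd_run (y : Mor V) (w : ℕ → Mor V) {m n : ℕ} (h : m ≤ n) :
    (run y w m).LeftDvd (run y w n) := by
  induction n, h using Nat.le_induction with
  | base => exact LeftDvd.refl _
  | succ n _ ih => exact ih.trans (leftDvd_mul_right _ _)

theorem isComp_run {w : ℕ → Mor V} (hw : IsPath w) (n : ℕ) :
    IsComp ((List.range n).map w) (w n) (run (one (w 0).cod) w (n + 1)) := by
  induction n with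
  | zero =>
    simp only [run, one_comp]
    exact .nil _
  | succ n ih =>
    rw [List.range_succ, List.map_append, run_succ]
    exact ih.concat (hw n)

theorem IsInfiniteNormalWord.isPath {w : ℕ → Mor V} (hw : IsInfiniteNormalWord S w) :
    IsPath w := fun n => (hw n).2.dom_eq

theorem IsInfiniteNormalWord.shift {w : ℕ → Mor V} (hw : IsInfiniteNormalWord S w) (m : ℕ) :
    IsInfiniteNormalWord S fun k => w (m + k) := fun n => hw (m + n)

theorem IsInfiniteNormalWord.tail {w : ℕ → Mor V} (hw : IsInfiniteNormalWord S w) :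
    IsInfiniteNormalWord S fun k => w (k + 1) := fun n => hw (n + 1)

variable [LeftCancellative V]

theorem leftDvd_of_leftDvd_run (hS : IsGarside S) {w : ℕ → Mor V}
    (hw : IsInfiniteNormalWord S w) {y r : Mor V} (hy : y.dom = (w 0).cod) (hr : r ∈ S) {n : ℕ}
    (h : r.LeftDvd (run y w n)) : r.LeftDvd (y * w 0) := by
  obtain _ | n := n
  · exact h.trans (leftDvd_mul_right _ _)
  induction n with
  | zero => exact h
  | succ n ih =>
    refine ih ?_
    have hd := dom_run hw.isPath hy n
    rw [run_succ, run_succ, comp_assoc hd (hw.isPath n)] at h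
    exact ((hw n).2.isHead (hw n).1).leftDvd_mul hS (by simpa using hd) hr h

/-- Let `w` be normal, and let `wₘ₋₁` be the head of `wₘ₋₁ b`. If a product of `N ≤ m` elements of
`S ∪ C*` divides `y w₀ ⋯ wₘ₋₁ b`, then it already divides `y w₀ ⋯ w_{N-1}`. Each factor is absorbed
by one letter of `w`. -/
theorem IsProd.leftDvd_run (hS : IsGarside S) {N : ℕ} {a : Mor V} (ha : IsProd S N a)
    {w : ℕ → Mor V} (hw : IsInfiniteNormalWord S w) {y b : Mor V} (hy : y.dom = (w 0).cod)
    {m : ℕ} (hb : (w m).cod = b.cod) (hhead : ∀ k, m = k + 1 → IsHead S (w k * b) (w k))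
    (hN : N ≤ m) (h : a.LeftDvd (run y w m * b)) : a.LeftDvd (run y w N) := by
  induction ha generalizing y w m with
  | zero u hu => exact hu.leftDvd (by simpa using h.cod_eq)
  | succ N s a hs hsa _ ih =>
    obtain ⟨m, rfl⟩ : ∃ k, m = k + 1 := ⟨m - 1, by omega⟩
    have h0 : s.LeftDvd (y * w 0) := by
      have hsb := (leftDvd_mul_right s a).trans h
      obtain hs | hs := hs
      · have hd := dom_run hw.isPath hy m
        rw [run_succ, comp_assoc hd ((hw.isPath m).trans hb)] at hsb
        exact leftDvd_of_leftDvd_run hS hw hy hs (n := m + 1)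
          ((hhead m rfl).leftDvd_mul hS (by simpa using hd) hs hsb)
      · exact hs.leftDvd (by simpa using hsb.cod_eq)
    obtain ⟨z, hz, hsz⟩ := leftDvd_iff.1 h0
    have hzd : z.dom = (w 1).cod := by
      rw [← dom_mul hz, ← hsz, dom_mul hy, hw.isPath]
    have hw' := hw.tail
    have hzr : ∀ k, (run z (fun k => w (k + 1)) k).dom = (w (k + 1)).cod :=
      dom_run hw'.isPath hzd
    rw [run_succ', hsz, ← mul_run hw'.isPath hzd hz] at h ⊢
    rw [comp_assoc (by simpa using hz) ((hzr m).trans hb)] at h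
    refine (ih hw' hzd hb ?_ (by omega) (h.of_mul_left hsa (by simpa using hz))).mul_left hsa
    rintro k rfl
    exact hhead (k + 1) rfl

/-- The first letter of a finite normal path is the head of its product. -/
theorem isHead_of_isComp (hS : IsGarside S) {l : List (Mor V)} {h u a : Mor V}
    (hl : IsNormalWord S (h :: l)) (hu : u.IsInv) (ha : IsComp (h :: l) u a) :
    IsHead S a h := by
  induction l generalizing h a with
  | nil =>
    cases ha with
    | cons _ _ _ x hx ha =>
      cases ha
      rw [mul_eq]
      exact ⟨hl.1 h (by simp), leftDvd_mul_right _ _,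
        fun r _ hr => (leftDvd_mul_isInv_iff hu).1 hr⟩
  | cons h' l ih =>
    cases ha with
    | cons _ _ _ x hx ha =>
      have hn : NormalPair S h h' := (List.isChain_cons_cons.1 hl.2).1
      have hx' := ih ⟨fun s hs => hl.1 s (by simp [hs]), (List.isChain_cons_cons.1 hl.2).2⟩ ha
      rw [mul_eq]
      exact ⟨hl.1 h (by simp), leftDvd_mul_right _ _,
        fun r hr hrx => (normalPair_iff.1 hn).2 r hr (hx'.leftDvd_mul hS hx hr hrx)⟩

/-- Splitting off heads of `x`, one for each factor of `a`, gives a left divisor `x'` of `x` with a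
normal form such that `a` still divides `y x'`. For `a = x` and `y` an identity, `x'` differs from
`x` by an invertible element only. -/
theorem exists_isFiniteNormalPath_between (hS : IsGarside S) (hSbdd : LocallyBounded S) {n : ℕ}
    {a : Mor V} (ha : IsProd S n a) {x y : Mor V} (hy : y.dom = x.cod)
    (h : a.LeftDvd (y * x)) : ∃ (l : List (Mor V)) (u x' : Mor V),
      IsFiniteNormalPath S l u x' ∧ x'.LeftDvd x ∧ a.LeftDvd (y * x') := by
  induction ha generalizing x y with
  | zero u hu =>
    exact ⟨[], one x.cod, one x.cod, ⟨⟨by simp, by simp⟩, isInv_one _, .nil _⟩,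
      (isInv_one _).leftDvd rfl, hu.leftDvd (by simpa using h.cod_eq)⟩
  | succ n s a hs hsa _ ih =>
    by_cases hx : x.IsInv
    · exact ⟨[], x, x, ⟨⟨by simp, by simp⟩, hx, .nil _⟩, LeftDvd.refl x, h⟩
    obtain ⟨t, ht⟩ := exists_isHead hS hSbdd hx
    obtain ⟨x₁, hx₁, rfl⟩ := leftDvd_iff.1 ht.2.1
    rw [cod_mul] at hy
    have h0 : s.LeftDvd (y * t) := by
      have hsb := (leftDvd_mul_right s a).trans h
      obtain hs | hs := hs
      · exact ht.leftDvd_mul hS (by simpa using hy) hs hsb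
      · exact hs.leftDvd (by simpa using hsb.cod_eq)
    obtain ⟨z, hz, hsz⟩ := leftDvd_iff.1 h0
    have hzd : z.dom = x₁.cod := by
      rw [← dom_mul hz, ← hsz, dom_mul hy, hx₁]
    rw [← comp_assoc hy hx₁, hsz, comp_assoc hz hzd] at h
    obtain ⟨l, u, x', ⟨hl, hu, hc⟩, hx', ha⟩ := ih hzd (h.of_mul_left hsa (by simpa using hz))
    have htx' : t.dom = x'.cod := hx₁.trans hx'.cod_eq.symm
    have htt : (t * x').LeftDvd (t * x₁) := hx'.mul_left htx'
    refine ⟨t :: l, u, t * x', ⟨⟨?_, ?_⟩, hu, ?_⟩, htt, ?_⟩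
    · rintro s (_ | ⟨_, hs⟩)
      exacts [ht.1, hl.1 s hs]
    · cases l with
      | nil => simp
      | cons t' l =>
        refine List.isChain_cons_cons.2 ⟨normalPair_iff.2 ⟨?_, fun r hr hrt => ?_⟩, hl.2⟩
        · exact htx'.trans hc.cod_eq
        · have ht'x' := (isHead_of_isComp hS hl hu hc).2.1
          exact ht.2.2 r hr ((hrt.trans (ht'x'.mul_left (htx'.trans hc.cod_eq))).trans htt)
    · rw [← mul_eq _ _ htx']
      exact .cons _ _ _ _ _ hc
    · rw [← comp_assoc hy htx', hsz, comp_assoc hz (hzd.trans hx'.cod_eq.symm)]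
      exact ha.mul_left hsa

theorem exists_isFiniteNormalPath (hS : IsGarside S) (hSbdd : LocallyBounded S) (a : Mor V) :
    ∃ (l : List (Mor V)) (u : Mor V), IsFiniteNormalPath S l u a := by
  obtain ⟨n, hn⟩ := hS.exists_isProd a
  obtain ⟨l, u, x, ⟨hl, hu, hx⟩, hxa, hax⟩ :=
    exists_isFiniteNormalPath_between hS hSbdd hn (x := a) (y := one a.cod) rfl
      (by simpa using LeftDvd.refl a)
  rw [← hxa.cod_eq, one_comp] at hax
  obtain ⟨v, hxv, hv, rfl⟩ := unitEq_iff.1 (hax.antisymm hxa)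
  exact ⟨l, u * v, hl, hu.mul hv, hx.mul_last (hx.dom_eq.symm.trans hxv)⟩

theorem IsFiniteNormalPath.isHead_headD (hS : IsGarside S) {l : List (Mor V)} {u a : Mor V}
    (h : IsFiniteNormalPath S l u a) (ha : ¬ a.IsInv) : IsHead S a (l.headD u) := by
  obtain ⟨hl, hu, hc⟩ := h
  cases l with
  | nil =>
    cases hc
    exact absurd hu ha
  | cons t l => exact isHead_of_isComp hS hl hu hc

omit [LeftCancellative V] in
/-- Two distinct elements with the same domain and target have, after removal of the longest common
prefix of their normal forms, different first letters. -/
theorem exists_common_prefix (hSinv : ∀ s ∈ S, ¬ s.IsInv) {la lb : List (Mor V)}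
    {ua ub a b : Mor V} (ha : IsFiniteNormalPath S la ua a) (hb : IsFiniteNormalPath S lb ub b)
    (hab : a ≠ b) (hcod : a.cod = b.cod) :
    ∃ (r a' b' : Mor V) (la' lb' : List (Mor V)), r.dom = a'.cod ∧ r.dom = b'.cod ∧
      a = r * a' ∧ b = r * b' ∧ IsFiniteNormalPath S la' ua a' ∧ IsFiniteNormalPath S lb' ub b' ∧
      la'.headD ua ≠ lb'.headD ub := by
  induction la generalizing lb a b with
  | nil =>
    refine ⟨one a.cod, a, b, [], lb, rfl, hcod, (one_comp a).symm, ?_, ha, hb, ?_⟩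
    · rw [hcod, one_comp]
    · cases ha.2.2
      cases lb with
      | nil =>
        cases hb.2.2
        exact hab
      | cons s lb =>
        rintro rfl
        exact hSinv _ (hb.1.1 _ (by simp)) ha.2.1
  | cons s la ih =>
    by_cases hh : (s :: la).headD ua = lb.headD ub
    · cases lb with
      | nil =>
        exact absurd hb.2.1 (hSinv _ (ha.1.1 _ (by simp [← show s = ub from hh])))
      | cons t lb =>
        obtain rfl : s = t := hh
        obtain ⟨ha1, ha2, ha3⟩ := ha
        obtain ⟨hb1, hb2, hb3⟩ := hb
        cases ha3 with
        | cons _ _ _ x hx ha3 =>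
        cases hb3 with
        | cons _ _ _ y hy hb3 =>
        have hxy : x ≠ y := by
          rintro rfl
          exact hab rfl
        obtain ⟨r, a', b', la', lb', h1, h2, rfl, rfl, h5, h6, h7⟩ := ih (a := x) (b := y)
          ⟨⟨fun t ht => ha1.1 t (List.mem_cons_of_mem _ ht), ha1.2.tail⟩, ha2, ha3⟩
          ⟨⟨fun t ht => hb1.1 t (List.mem_cons_of_mem _ ht), hb1.2.tail⟩, hb2, hb3⟩ hxy
          (hx.symm.trans hy)
        rw [cod_mul] at hx
        refine ⟨s * r, a', b', la', lb', (dom_mul hx).trans h1, (dom_mul hx).trans h2, ?_, ?_,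
          h5, h6, h7⟩
        · rw [mul_eq, comp_assoc hx h1]
        · rw [mul_eq, comp_assoc hx h2]
    · refine ⟨one a.cod, a, b, _, lb, rfl, hcod, (one_comp a).symm, ?_, ha, hb, hh⟩
      rw [hcod, one_comp]

end Words

/-! ### The left inverse hull acting on right ideals -/

section HullAction

open Mor

variable {V : Type u} [Category.{v} V] [LeftCancellative V] {S T : Set (Mor V)} {D : Set V}

theorem mem_leftMul {c x y : Mor V} : y ∈ leftMul c x ↔ c.dom = x.cod ∧ y = c * x := by
  classical
  change (if h : c.dom = x.cod then some (c.mul x h) else none) = some y ↔ _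
  by_cases h : c.dom = x.cod
  · rw [dif_pos h, Option.some_inj, mul_eq]
    exact ⟨fun h' => ⟨h, h'.symm⟩, fun h' => h'.2.symm⟩
  · simp [h]

/-- Elements of the left inverse hull commute with multiplication from the right. -/
theorem InHull.equivariant {s : Mor V ≃. Mor V} (hs : InHull s) {x y : Mor V} (hy : y ∈ s x) :
    x.dom = y.dom ∧ ∀ z : Mor V, x.dom = z.cod → y * z ∈ s (x * z) := by
  induction hs generalizing x y with
  | gen c =>
    obtain ⟨h, rfl⟩ := mem_leftMul.1 hy
    refine ⟨(dom_mul h).symm, fun z hz => mem_leftMul.2 ⟨by simpa using h, ?_⟩⟩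
    rw [comp_assoc h hz]
  | comp s t _ _ ihs iht =>
    obtain ⟨x', hx', hy⟩ := (PEquiv.mem_trans _ _ _ _).1 hy
    obtain ⟨h1, h2⟩ := iht hx'
    obtain ⟨h3, h4⟩ := ihs hy
    exact ⟨h1.trans h3, fun z hz =>
      (PEquiv.mem_trans _ _ _ _).2 ⟨x' * z, h2 z hz, h4 z (h1.symm.trans hz)⟩⟩
  | inv s _ ih =>
    obtain ⟨h1, h2⟩ := ih ((PEquiv.mem_iff_mem s).1 hy)
    exact ⟨h1.symm, fun z hz => (PEquiv.mem_iff_mem s).2 (h2 z (h1.trans hz))⟩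

theorem InHull.map_run {s : Mor V ≃. Mor V} (hs : InHull s) {x y : Mor V} (hy : y ∈ s x)
    {w : ℕ → Mor V} (hw : IsPath w) (hx : x.dom = (w 0).cod) (n : ℕ) :
    run y w n ∈ s (run x w n) := by
  induction n with
  | zero => exact hy
  | succ n ih => exact (hs.equivariant ih).2 _ (dom_run hw hx n)

theorem Idem.mem_of_leftDvd (e : Idem V) {x y : Mor V} (hx : x ∈ e.1) (h : x.LeftDvd y) :
    y ∈ e.1 := by
  obtain ⟨s, hs⟩ := e.2
  rw [hs] at hx ⊢
  obtain ⟨x', hx'⟩ := hx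
  obtain ⟨z, hz, rfl⟩ := leftDvd_iff.1 h
  exact ⟨_, (s.2.equivariant hx').2 z hz⟩

theorem Idem.ideal_subset_iff (e : Idem V) {x : Mor V} : x.ideal ⊆ e.1 ↔ x ∈ e.1 :=
  ⟨fun h => h (LeftDvd.refl x), fun h _ hy => e.mem_of_leftDvd h hy⟩

/-- The principal right ideal `a C` as an element of `J`. -/
noncomputable def Idem.principal (a : Mor V) : Idem V :=
  ⟨a.ideal, Hull.inv ⟨leftMul a, .gen a⟩, by
    ext y
    change a.LeftDvd y ↔ ∃ x, x ∈ (leftMul a).symm y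
    simp only [leftDvd_iff, PEquiv.mem_iff_mem, mem_leftMul]⟩

@[simp] theorem Idem.mem_principal {a x : Mor V} : x ∈ (Idem.principal a).1 ↔ a.LeftDvd x :=
  Iff.rfl

/-! ### Finite generation of the constructible right ideals -/

/-- The set `A` is a finite union of principal right ideals. -/
def FinGen (A : Set (Mor V)) : Prop :=
  ∃ F : Set (Mor V), F.Finite ∧ ∀ x, x ∈ A ↔ ∃ f ∈ F, f.LeftDvd x

omit [LeftCancellative V] in
theorem FinGen.inter (halign : FinitelyAligned V) {A B : Set (Mor V)} (hA : FinGen A)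
    (hB : FinGen B) : FinGen (A ∩ B) := by
  obtain ⟨F, hF, hA⟩ := hA
  obtain ⟨G, hG, hB⟩ := hB
  choose K hK using halign
  refine ⟨⋃ f ∈ F, ⋃ g ∈ G, (K f g : Set (Mor V)),
    hF.biUnion fun f _ => hG.biUnion fun g _ => (K f g).finite_toSet, fun x => ?_⟩
  have hK' : ∀ f g x, f.LeftDvd x ∧ g.LeftDvd x ↔ ∃ k ∈ K f g, k.LeftDvd x := fun f g x => by
    have := Set.ext_iff.1 (hK f g) x
    simpa [Mor.ideal] using this
  simp only [Set.mem_inter_iff, hA, hB, Set.mem_iUnion, Finset.mem_coe, exists_prop]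
  constructor
  · rintro ⟨⟨f, hf, hfx⟩, g, hg, hgx⟩
    obtain ⟨k, hk, hkx⟩ := (hK' f g x).1 ⟨hfx, hgx⟩
    exact ⟨k, ⟨f, hf, g, hg, hk⟩, hkx⟩
  · rintro ⟨k, ⟨f, hf, g, hg, hk⟩, hkx⟩
    obtain ⟨hfx, hgx⟩ := (hK' f g x).2 ⟨k, hk, hkx⟩
    exact ⟨⟨f, hf, hfx⟩, g, hg, hgx⟩

/-- If `A` is contained in the range of `t`, then `t` matches generators of `t⁻¹ A` with those of
`A`. -/
theorem FinGen.preimage {t : Mor V ≃. Mor V} (ht : InHull t) {A : Set (Mor V)} (hA : FinGen A)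
    (hAt : ∀ y ∈ A, ∃ x, y ∈ t x) : FinGen {x | ∃ y, y ∈ t x ∧ y ∈ A} := by
  obtain ⟨F, hF, hA⟩ := hA
  have : ∀ f, ∃ x, f ∈ F → f ∈ t x := fun f => by
    by_cases hf : f ∈ F
    · obtain ⟨x, hx⟩ := hAt f ((hA f).2 ⟨f, hf, LeftDvd.refl f⟩)
      exact ⟨x, fun _ => hx⟩
    · exact ⟨f, fun h => absurd h hf⟩
  choose g hg using this
  refine ⟨g '' F, hF.image g, fun x => ?_⟩
  simp only [Set.mem_ofPred_eq, Set.exists_mem_image]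
  constructor
  · rintro ⟨y, hy, hyA⟩
    obtain ⟨f, hf, hfy⟩ := (hA y).1 hyA
    obtain ⟨z, hz, rfl⟩ := leftDvd_iff.1 hfy
    obtain ⟨h1, h2⟩ := ht.equivariant (hg f hf)
    rw [t.inj (hy) (h2 z (h1.trans hz))]
    exact ⟨f, hf, leftDvd_mul_right _ _⟩
  · rintro ⟨f, hf, hfx⟩
    obtain ⟨z, hz, rfl⟩ := leftDvd_iff.1 hfx
    exact ⟨f * z, (ht.equivariant (hg f hf)).2 z hz,
      (hA _).2 ⟨f, hf, leftDvd_mul_right _ _⟩⟩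

theorem InHull.finGen (halign : FinitelyAligned V) {s : Mor V ≃. Mor V} (hs : InHull s) :
    FinGen {x | ∃ y, y ∈ s x} ∧ FinGen {x | ∃ y, y ∈ s.symm x} := by
  have comp : ∀ s t : Mor V ≃. Mor V, InHull t → FinGen {x | ∃ y, y ∈ s x} →
      FinGen {x | ∃ y, y ∈ t.symm x} → FinGen {x | ∃ y, y ∈ (t.trans s) x} := by
    intro s t ht h1 h2
    have h3 := FinGen.preimage ht (h1.inter halign h2)
      (fun y hy => hy.2.imp fun x hx => (PEquiv.mem_iff_mem t).1 hx)
    convert h3 using 1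
    ext x
    simp only [PEquiv.mem_trans, Set.mem_ofPred_eq, Set.mem_inter_iff, PEquiv.mem_iff_mem]
    constructor
    · rintro ⟨z, y, hy, hz⟩
      exact ⟨y, hy, ⟨z, hz⟩, x, hy⟩
    · rintro ⟨y, hy, ⟨z, hz⟩, -⟩
      exact ⟨z, y, hy, hz⟩
  induction hs with
  | gen c =>
    refine ⟨⟨{one c.dom}, Set.finite_singleton _, fun x => ?_⟩,
      ⟨{c}, Set.finite_singleton _, fun x => ?_⟩⟩
    · simp only [Set.mem_ofPred_eq, mem_leftMul, Set.mem_singleton_iff, exists_eq_left]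
      exact ⟨fun ⟨_, h, _⟩ => (isInv_one _).leftDvd h, fun h => ⟨_, h.cod_eq, rfl⟩⟩
    · simp only [Set.mem_ofPred_eq, PEquiv.mem_iff_mem, mem_leftMul, Set.mem_singleton_iff,
        exists_eq_left, leftDvd_iff]
  | comp s t hs ht ihs iht =>
    refine ⟨comp s t ht ihs.1 iht.2, ?_⟩
    exact comp t.symm s.symm (.inv s hs) iht.2 (by rw [PEquiv.symm_symm]; exact ihs.1)
  | inv s _ ih =>
    rw [PEquiv.symm_symm]
    exact ⟨ih.2, ih.1⟩

theorem Idem.finGen (halign : FinitelyAligned V) (e : Idem V) : FinGen e.1 := by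
  obtain ⟨s, hs⟩ := e.2
  rw [hs]
  exact (s.2.finGen halign).1

/-! ### Characters of paths -/

/-- `χ` is the character of the infinite path `y w₀ w₁ ⋯`. -/
def IsCharOfRun (χ : Omega V) (y : Mor V) (w : ℕ → Mor V) : Prop :=
  ∀ e : Idem V, χ.1 e = true ↔ ∃ n, run y w n ∈ e.1

theorem isCharOf_iff {χ : Omega V} {x : Mor V} :
    IsCharOf χ x ↔ ∀ e : Idem V, χ.1 e = true ↔ x ∈ e.1 := by
  simp only [IsCharOf, Idem.ideal_subset_iff]

theorem isCharOfInfinite_iff {χ : Omega V} {w : ℕ → Mor V} (hw : IsPath w) :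
    IsCharOfInfinite χ w ↔ IsCharOfRun χ (one (w 0).cod) w := by
  refine forall_congr' fun e => ?_
  have : (∃ (n : ℕ) (x : Mor V), IsComp ((List.range n).map w) (w n) x ∧ x ∈ e.1) ↔
      ∃ n, run (one (w 0).cod) w n ∈ e.1 := by
    constructor
    · rintro ⟨n, x, hx, hxe⟩
      rw [hx.unique (isComp_run hw n)] at hxe
      exact ⟨_, hxe⟩
    · rintro ⟨n, hn⟩
      exact ⟨n, _, isComp_run hw n, e.mem_of_leftDvd hn (run_leftDvd_run _ _ n.le_succ)⟩
  rw [this]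

theorem exists_isCharOfRun (y : Mor V) (w : ℕ → Mor V) : ∃ χ : Omega V, IsCharOfRun χ y w := by
  classical
  refine ⟨⟨fun e => decide (∃ n, run y w n ∈ e.1), ⟨?_, ?_, ?_⟩, ?_⟩, fun e => by simp⟩
  · exact ⟨Idem.principal y, decide_eq_true ⟨0, LeftDvd.refl y⟩⟩
  · intro e f
    rw [← Bool.decide_and, decide_eq_decide]
    constructor
    · rintro ⟨n, he, hf⟩
      exact ⟨⟨n, he⟩, n, hf⟩
    · rintro ⟨⟨m, he⟩, n, hf⟩
      exact ⟨max m n, e.mem_of_leftDvd he (run_leftDvd_run _ _ (le_max_left m n)),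
        f.mem_of_leftDvd hf (run_leftDvd_run _ _ (le_max_right m n))⟩
  · intro e he
    simp [he]
  · intro e F _ he h
    obtain ⟨n, hn⟩ := of_decide_eq_true h
    rw [he] at hn
    simp only [Set.mem_iUnion, exists_prop] at hn
    obtain ⟨f, hf, hn⟩ := hn
    exact ⟨f, hf, decide_eq_true ⟨n, hn⟩⟩

theorem isCharOf_act {s : Hull V} {χ : Omega V} (h : χ.1 s.supp = true) {x : Mor V}
    (hχ : IsCharOf χ x) : ∃ y, y ∈ s.1 x ∧ IsCharOf (act s χ h) y := by
  rw [isCharOf_iff] at hχ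
  obtain ⟨y, hy⟩ := (hχ _).1 h
  refine ⟨y, hy, isCharOf_iff.2 fun e => (hχ _).trans ?_⟩
  constructor
  · rintro ⟨y', hy', he⟩
    rwa [Option.mem_unique hy hy']
  · exact fun he => ⟨y, hy, he⟩

/-- `s` maps the character of `x w₀ w₁ ⋯` to the character of `s(x) w₀ w₁ ⋯`. -/
theorem isCharOfRun_act {s : Hull V} {χ : Omega V} (h : χ.1 s.supp = true) {x y : Mor V}
    (hy : y ∈ s.1 x) {w : ℕ → Mor V} (hw : IsPath w) (hx : x.dom = (w 0).cod)
    (hχ : IsCharOfRun χ x w) : IsCharOfRun (act s χ h) y w := by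
  refine fun e => (hχ _).trans (exists_congr fun n => ?_)
  have := s.2.map_run hy hw hx n
  constructor
  · rintro ⟨y', hy', he⟩
    rwa [Option.mem_unique this hy']
  · exact fun he => ⟨_, this, he⟩

theorem IsCharOfRun.shift {χ : Omega V} {y : Mor V} {w : ℕ → Mor V} (h : IsCharOfRun χ y w)
    (m : ℕ) : IsCharOfRun χ (run y w m) fun k => w (m + k) := by
  refine fun e => (h e).trans ?_
  simp only [← run_add]
  exact ⟨fun ⟨n, hn⟩ => ⟨n, e.mem_of_leftDvd hn (run_leftDvd_run _ _ (by omega))⟩,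
    fun ⟨n, hn⟩ => ⟨_, hn⟩⟩

/-! ### Invariance of `X(T, D)` -/

omit [LeftCancellative V] in
theorem HInvariant.exists_isHead_mul (hinv : HInvariant S T D) {a x : Mor V} (ha : ¬ a.IsInv)
    (hx : x ∈ T) (h : a.dom = x.cod) : ∃ t ∈ T, IsHead S (a * x) t := by
  obtain ⟨t, ht, h'⟩ := hinv a ha x (.inl hx) h
  exact ⟨t, ht, by rwa [← mul_eq]⟩

theorem HInvariant.mem_of_normalPair (hinv : HInvariant S T D) (hSinv : ∀ s ∈ S, ¬ s.IsInv)
    (hStrans : Transverse S) {s t : Mor V} (hs : s ∈ S) (ht : t ∈ T) (h : NormalPair S s t) :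
    s ∈ T := by
  obtain ⟨r, hr, h'⟩ := hinv.exists_isHead_mul (hSinv s hs) ht h.dom_eq
  rwa [(h.isHead hs).unique hStrans h']

theorem HInvariant.mem_of_isNormalWord (hinv : HInvariant S T D) (hSinv : ∀ s ∈ S, ¬ s.IsInv)
    (hStrans : Transverse S) {l : List (Mor V)} {x : V} {a : Mor V} (hl : IsNormalWord S l)
    (ha : IsComp l (one x) a) (hx : x ∈ D) : ∀ t ∈ l, t ∈ T := by
  induction l generalizing a with
  | nil => simp
  | cons s l ih =>
    cases ha with
    | cons _ _ _ y hy ha =>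
    have hs := hl.1 s (by simp)
    have hlT := ih ⟨fun t ht => hl.1 t (by simp [ht]), hl.2.tail⟩ ha
    rintro t (_ | ⟨_, ht⟩)
    · cases l with
      | nil =>
        cases ha
        obtain ⟨r, hr, h'⟩ := hinv s (hSinv s hs) (one x) (.inr ⟨x, hx, rfl⟩) hy
        have : s.dom = x := hy
        subst this
        rw [mul_eq, comp_one] at h'
        rwa [(isHead_self hs).unique hStrans h']
      | cons s' l =>
        exact hinv.mem_of_normalPair hSinv hStrans hs (hlT s' (by simp))
          (List.isChain_cons_cons.1 hl.2).1
    · exact hlT t ht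

omit [LeftCancellative V] in
theorem IsComp.exists_one {l : List (Mor V)} {u a : Mor V} (h : IsComp l u a) :
    ∃ b : Mor V, IsComp l (one u.cod) b ∧ b.dom = u.cod ∧ a = b * u := by
  induction h with
  | nil u => exact ⟨_, .nil _, rfl, (one_comp u).symm⟩
  | cons s l u x h _ ih =>
    obtain ⟨b, hb, hbd, rfl⟩ := ih
    rw [cod_mul] at h
    exact ⟨s.mul b h, .cons _ _ _ _ _ hb, hbd, by rw [mul_eq, mul_eq, comp_assoc h hbd]⟩

/-- The element `x` need not be a product of letters in `T`: the last letter `s` of its normal form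
is `H(s · d(s))`, where `d(s)` lies in `D` since it is isomorphic to the domain of `x`, so all
letters lie in `T` by `H`-invariance. -/
theorem mem_spaceOf_of_isCharOf (hS : IsGarside S) (hSinv : ∀ s ∈ S, ¬ s.IsInv)
    (hStrans : Transverse S) (hSbdd : LocallyBounded S) (hinv : HInvariant S T D)
    (hiso : IsoClosed D) {χ : Omega V} {x : Mor V} (hx : x.dom ∈ D) (hχ : IsCharOf χ x) :
    χ ∈ spaceOf S T D := by
  obtain ⟨l, u, hl, hu, hc⟩ := exists_isFiniteNormalPath hS hSbdd x
  obtain ⟨b, hb, hbu, rfl⟩ := hc.exists_one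
  have hu' : IsIso u.hom := hu
  have huD : u.cod ∈ D := hiso _ (by rwa [dom_mul hbu] at hx) _ ⟨asIso u.hom⟩
  refine .inr ⟨l, u.cod, b, huD, hl, hinv.mem_of_isNormalWord hSinv hStrans hl hb huD, hb, ?_⟩
  rw [isCharOf_iff] at hχ ⊢
  exact fun e => (hχ e).trans ⟨fun h => e.mem_of_leftDvd h ((LeftDvd.refl b).mul_isInv hu),
    fun h => e.mem_of_leftDvd h (leftDvd_mul_right b u)⟩

/-- The normal form of `c w` for an infinite normal word `w` with letters in `T`: its letters
`hₖ = H(cₖ wₖ)` are computed recursively by `c₀ = c` and `cₖ wₖ = hₖ cₖ₊₁`, and they lie in `T` by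
`H`-invariance, since also `hₖ = H(cₖ wₖ wₖ₊₁)`. -/
theorem exists_infinite_normalForm (hS : IsGarside S) (hSinv : ∀ s ∈ S, ¬ s.IsInv)
    (hStrans : Transverse S) (hSbdd : LocallyBounded S) (hinv : HInvariant S T D)
    {w : ℕ → Mor V} (hw : IsInfiniteNormalWord S w) (hwT : ∀ n, w n ∈ T) {c : Mor V}
    (hc : c.dom = (w 0).cod) :
    ∃ h : ℕ → Mor V, IsInfiniteNormalWord S h ∧ (∀ n, h n ∈ T) ∧ (h 0).cod = c.cod ∧
      (∀ k, (run (one c.cod) h k).LeftDvd (run c w k)) ∧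
      ∀ k, ∃ m, (run c w k).LeftDvd (run (one c.cod) h m) := by
  have step : ∀ (k : ℕ) (c : Mor V), ∃ p : Mor V × Mor V, c.dom = (w k).cod →
      IsHead S (c * w k) p.1 ∧ p.1.dom = p.2.cod ∧ c * w k = p.1 * p.2 := by
    intro k c
    by_cases hc : c.dom = (w k).cod
    · obtain ⟨h, hh⟩ := exists_isHead hS hSbdd (a := c * w k)
        fun h => hSinv _ (hw k).1 (h.of_mul_right hc)
      obtain ⟨c', hc', h'⟩ := leftDvd_iff.1 hh.2.1
      exact ⟨(h, c'), fun _ => ⟨hh, hc', h'⟩⟩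
    · exact ⟨(c, c), fun h => absurd h hc⟩
  choose f hf using step
  set C : ℕ → Mor V := fun n => Nat.rec c (fun k c => (f k c).2) n with hC
  set h : ℕ → Mor V := fun k => (f k (C k)).1 with hh
  have hCd : ∀ k, (C k).dom = (w k).cod := by
    intro k
    induction k with
    | zero => exact hc
    | succ k ih =>
      obtain ⟨-, h2, h3⟩ := hf k (C k) ih
      have := congrArg Mor.dom h3
      rw [dom_mul ih, dom_mul h2] at this
      exact this.symm.trans (hw.isPath k)
  have hhead : ∀ k, IsHead S (C k * w k) (h k) := fun k => (hf k (C k) (hCd k)).1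
  have hhC : ∀ k, (h k).dom = (C (k + 1)).cod := fun k => (hf k (C k) (hCd k)).2.1
  have hCh : ∀ k, C k * w k = h k * C (k + 1) := fun k => (hf k (C k) (hCd k)).2.2
  have hpath : IsPath h := fun k => by
    rw [hhC, ← (hhead (k + 1)).2.1.cod_eq.symm, cod_mul]
  have hh0 : (h 0).cod = c.cod := by
    rw [(hhead 0).2.1.cod_eq, cod_mul]
    rfl
  have hhead' : ∀ k, IsHead S (C k * w k * w (k + 1)) (h k) := by
    intro k
    refine ⟨(hhead k).1, (hhead k).2.1.trans (leftDvd_mul_right _ _), fun r hr hrd => ?_⟩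
    rw [comp_assoc (hCd k) (hw.isPath k)] at hrd
    exact (hhead k).2.2 r hr (((hw k).2.isHead (hw k).1).leftDvd_mul hS
      (by simpa using hCd k) hr hrd)
  have hhn : IsInfiniteNormalWord S h := fun k => by
    refine ⟨(hhead k).1, normalPair_iff.2 ⟨hpath k, fun r hr hrd => ?_⟩⟩
    refine (hhead' k).2.2 r hr (hrd.trans ?_)
    rw [hCh, comp_assoc (hhC k) (hCd (k + 1))]
    exact (hhead (k + 1)).2.1.mul_left (hpath k)
  have hrun : ∀ k, run c w k = run (one c.cod) h k * C k := by
    intro k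
    induction k with
    | zero => exact (one_comp c).symm
    | succ k ih =>
      have hd := dom_run hpath (y := one c.cod) hh0.symm k
      rw [run_succ, ih, comp_assoc (hd.trans _) (hCd k), hCh, run_succ, comp_assoc hd (hhC k)]
      rw [(hhead k).2.1.cod_eq, cod_mul]
  refine ⟨h, hhn, fun k => ?_, hh0, fun k => ?_, fun k => ?_⟩
  · obtain ⟨t, ht, htt⟩ := hinv.exists_isHead_mul
      (fun h => hSinv _ (hw k).1 (h.of_mul_right (hCd k))) (hwT (k + 1))
      ((dom_mul (hCd k)).trans (hw.isPath k))
    rwa [(hhead' k).unique hStrans htt]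
  · rw [hrun]
    exact leftDvd_mul_right _ _
  · obtain ⟨N, hN⟩ := hS.exists_isProd (run c w k)
    refine ⟨N, hN.leftDvd_run hS hhn (m := max k N) (b := C (max k N)) hh0.symm ?_ ?_
      (le_max_right _ _) ?_⟩
    · rw [(hhead _).2.1.cod_eq, cod_mul]
    · rintro j hj
      rw [hj, ← hCh]
      exact hhead j
    · rw [← hrun]
      exact run_leftDvd_run _ _ (le_max_left _ _)

theorem mem_spaceOf_of_isCharOfRun (hS : IsGarside S) (hSinv : ∀ s ∈ S, ¬ s.IsInv)
    (hStrans : Transverse S) (hSbdd : LocallyBounded S) (hinv : HInvariant S T D)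
    {w : ℕ → Mor V} (hw : IsInfiniteNormalWord S w) (hwT : ∀ n, w n ∈ T) {c : Mor V}
    (hc : c.dom = (w 0).cod) {χ : Omega V} (hχ : IsCharOfRun χ c w) : χ ∈ spaceOf S T D := by
  obtain ⟨h, hh, hhT, hh0, h1, h2⟩ :=
    exists_infinite_normalForm hS hSinv hStrans hSbdd hinv hw hwT hc
  refine .inl ⟨h, hh, hhT, (isCharOfInfinite_iff hh.isPath).2 fun e => (hχ e).trans ?_⟩
  rw [hh0]
  constructor
  · rintro ⟨k, hk⟩
    exact (h2 k).imp fun m hm => e.mem_of_leftDvd hk hm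
  · rintro ⟨k, hk⟩
    exact ⟨k, e.mem_of_leftDvd hk (h1 k)⟩

theorem invariant_spaceOf (hS : IsGarside S) (hSinv : ∀ s ∈ S, ¬ s.IsInv)
    (hStrans : Transverse S) (hSbdd : LocallyBounded S) (hinv : HInvariant S T D)
    (hiso : IsoClosed D) : Invariant (spaceOf S T D : Set (Omega V)) := by
  rintro χ (⟨w, hw, hwT, hχ⟩ | ⟨l, x, a, hx, hl, hlT, ha, hχ⟩) s h
  · rw [isCharOfInfinite_iff hw.isPath] at hχ
    obtain ⟨n, y, hy⟩ := (hχ _).1 h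
    have hd := dom_run hw.isPath (y := one (w 0).cod) rfl n
    exact mem_spaceOf_of_isCharOfRun hS hSinv hStrans hSbdd hinv (hw.shift n)
      (fun k => hwT (n + k)) ((s.2.equivariant hy).1.symm.trans hd)
      (isCharOfRun_act h hy (hw.shift n).isPath hd (hχ.shift n))
  · obtain ⟨y, hy, hχ'⟩ := isCharOf_act h hχ
    refine mem_spaceOf_of_isCharOf hS hSinv hStrans hSbdd hinv hiso ?_ hχ'
    rw [← (s.2.equivariant hy).1, ha.dom_eq]
    exact hx

theorem Invariant.diff {X Y : Set (Omega V)} (hX : Invariant X) (hY : Invariant Y) :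
    Invariant (X \ Y) := by
  refine fun χ hχ s h => ⟨hX χ hχ.1 s h, fun hmem => hχ.2 ?_⟩
  have h' := h
  rw [← supp_inv_mul_self] at h'
  have hinv : (act s χ h).1 s.inv.supp = true := by
    change χ.1 (s.pull s.inv.supp) = true
    rwa [← supp_mul]
  have : act s.inv (act s χ h) hinv = χ := by
    refine Eq.trans ?_ (act_inv_mul_self s χ h h')
    apply Omega.ext
    funext e
    change χ.1 (s.pull (s.inv.pull e)) = χ.1 ((s.inv.mul s).pull e)
    rw [pull_mul]
  rw [← this]
  exact hY _ hmem _ _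

/-! ### Uniqueness of infinite normal forms -/

theorem leftDvd_of_run_leftDvd_run (hS : IsGarside S) {w w' : ℕ → Mor V} (hw0 : w 0 ∈ S)
    (hw' : IsInfiniteNormalWord S w') {y : Mor V} (hy : y.dom = (w 0).cod)
    (hy' : y.dom = (w' 0).cod) (h : ∀ k, ∃ m, (run y w k).LeftDvd (run y w' m)) :
    (w 0).LeftDvd (w' 0) := by
  obtain ⟨m, hm⟩ := h 1
  have h1 : y * one y.dom = y := comp_one y
  rw [← h1, ← mul_run hw'.isPath (y := one y.dom) hy' rfl m, h1] at hm
  have := leftDvd_of_leftDvd_run hS hw' (y := one y.dom) hy' hw0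
    (LeftDvd.of_mul_left hy (by simp) hm)
  rwa [hy', one_comp] at this

/-- An infinite normal word is determined by the elements which divide its initial products. -/
theorem eq_of_run_leftDvd (hS : IsGarside S) (hStrans : Transverse S) {w w' : ℕ → Mor V}
    (hw : IsInfiniteNormalWord S w) (hw' : IsInfiniteNormalWord S w') {y : Mor V}
    (hy : y.dom = (w 0).cod) (hy' : y.dom = (w' 0).cod)
    (h : ∀ k, ∃ m, (run y w k).LeftDvd (run y w' m))
    (h' : ∀ k, ∃ m, (run y w' k).LeftDvd (run y w m)) (n : ℕ) : w n = w' n := by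
  have h0 : w 0 = w' 0 := hStrans _ (hw 0).1 _ (hw' 0).1
    ((leftDvd_of_run_leftDvd_run hS (hw 0).1 hw' hy hy' h).antisymm
      (leftDvd_of_run_leftDvd_run hS (hw' 0).1 hw hy' hy h'))
  induction n generalizing w w' y with
  | zero => exact h0
  | succ n ih =>
    have tail : ∀ w w' : ℕ → Mor V, w 0 = w' 0 →
        (∀ k, ∃ m, (run y w k).LeftDvd (run y w' m)) →
        ∀ k, ∃ m, (run (y * w 0) (fun k => w (k + 1)) k).LeftDvd
          (run (y * w 0) (fun k => w' (k + 1)) m) := fun w w' h0 h k => by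
      obtain ⟨m, hm⟩ := h (k + 1)
      refine ⟨m, ?_⟩
      rw [← run_succ', h0, ← run_succ']
      exact hm.trans (run_leftDvd_run _ _ m.le_succ)
    have hyd : (y * w 0).dom = (w 1).cod := (dom_mul hy).trans (hw.isPath 0)
    have hyd' : (y * w 0).dom = (w' 1).cod := by rw [dom_mul hy, h0, hw'.isPath 0]
    have g := tail w w' h0 h
    have g' := tail w' w h0.symm h'
    rw [← h0] at g'
    refine ih hw.tail hw'.tail hyd hyd' g g' (hStrans _ (hw 1).1 _ (hw' 1).1 ?_)
    exact (leftDvd_of_run_leftDvd_run hS (hw 1).1 hw'.tail hyd hyd' g).antisymm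
      (leftDvd_of_run_leftDvd_run hS (hw' 1).1 hw.tail hyd' hyd g')

/-- The character of an infinite normal word with a letter outside `T` is not in `X(T, D)`. -/
theorem notMem_spaceOf_of_isCharOfRun (hS : IsGarside S) (hSinv : ∀ s ∈ S, ¬ s.IsInv)
    (hStrans : Transverse S) {w : ℕ → Mor V} (hw : IsInfiniteNormalWord S w) {n : ℕ}
    (hn : w n ∉ T) {χ : Omega V} (hχ : IsCharOfRun χ (one (w 0).cod) w) :
    χ ∉ spaceOf S T D := by
  rintro (⟨w', hw', hwT', hχ'⟩ | ⟨l, x, a, hx, hl, hlT, ha, hχ'⟩)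
  · rw [isCharOfInfinite_iff hw'.isPath] at hχ'
    have h : ∀ k, ∃ m, (run (one (w 0).cod) w k).LeftDvd (run (one (w' 0).cod) w' m) :=
      fun k => (hχ' (Idem.principal _)).1 ((hχ _).2 ⟨k, LeftDvd.refl _⟩)
    have h' : ∀ k, ∃ m, (run (one (w' 0).cod) w' k).LeftDvd (run (one (w 0).cod) w m) :=
      fun k => (hχ (Idem.principal _)).1 ((hχ' _).2 ⟨k, LeftDvd.refl _⟩)
    have hcod : (w 0).cod = (w' 0).cod := by
      obtain ⟨m, hm⟩ := h 0
      simpa using hm.cod_eq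
    rw [← hcod] at h h'
    exact hn (eq_of_run_leftDvd hS hStrans hw hw' rfl hcod h h' n ▸ hwT' n)
  · rw [isCharOf_iff] at hχ'
    obtain ⟨m, hm⟩ := (hχ (Idem.principal a)).1 ((hχ' _).2 (LeftDvd.refl a))
    have := (hχ' (Idem.principal _)).1 ((hχ _).2 ⟨m + 1, LeftDvd.refl _⟩)
    exact hSinv _ (hw m).1 (isInv_of_mul_leftDvd (dom_run hw.isPath rfl m) (this.trans hm))

end HullAction

/-! ### Open bisections of the transformation groupoid -/

section TransformationGroupoid

open Mor

variable {V : Type u} [Category.{v} V] [LeftCancellative V] {Y : Set (Omega V)}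

theorem isOpen_setOf_eq_true (e : Idem V) : IsOpen {χ : UnitPt Y | χ.val.1 e = true} := by
  have h : Continuous fun χ : UnitPt Y => χ.val.1 e :=
    (continuous_apply e).comp (continuous_induced_dom.comp continuous_induced_dom)
  exact (isOpen_discrete {true}).preimage h

/-- Every neighbourhood of `χ` contains all characters which agree with `χ` on a suitable finite
set. -/
theorem exists_finset_of_isOpen {U : Set (UnitPt Y)} (hU : IsOpen U) {χ : UnitPt Y} (hχ : χ ∈ U) :
    ∃ F : Finset (Idem V), ∀ ψ : UnitPt Y, (∀ e ∈ F, ψ.val.1 e = χ.val.1 e) → ψ ∈ U := by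
  obtain ⟨U', hU', rfl⟩ := isOpen_induced_iff.1 hU
  obtain ⟨U'', hU'', rfl⟩ := isOpen_induced_iff.1 hU'
  obtain ⟨F, u, hu, hF⟩ := isOpen_pi_iff.1 hU'' χ.val.1 hχ
  exact ⟨F, fun ψ hψ => hF fun e he => by rw [hψ e he]; exact (hu e he).2⟩

theorem act_congr {s t : Hull V} {χ : Omega V} {e : Idem V} (he : χ.1 e = true)
    (hst : ∀ x ∈ e.1, s.1 x = t.1 x) (hs : χ.1 s.supp = true) :
    ∃ ht : χ.1 t.supp = true, act s χ hs = act t χ ht := by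
  have key : ∀ s t : Hull V, (∀ x ∈ e.1, s.1 x = t.1 x) → ∀ f,
      χ.1 (s.pull f) = true → χ.1 (t.pull f) = true := by
    intro s t hst f hf
    refine χ.mono (e := e.inter (s.pull f)) ?_ (by rw [χ.2.1.mul, he, hf]; rfl)
    rintro x ⟨hxe, y, hy, hyf⟩
    exact ⟨y, by rwa [← hst x hxe], hyf⟩
  have ht : χ.1 t.supp = true := by
    refine χ.mono (e := e.inter s.supp) ?_ (by rw [χ.2.1.mul, he, hs]; rfl)
    rintro x ⟨hxe, y, hy⟩
    exact ⟨y, by rwa [← hst x hxe]⟩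
  refine ⟨ht, Omega.ext (funext fun f => ?_)⟩
  exact Bool.eq_iff_iff.2 ⟨key s t hst f, key t s (fun x hx => (hst x hx).symm) f⟩

/-- The sets `[s, U]` form a basis of the topology. -/
theorem exists_germSet_subset {γ : Set (Mor (UnitPt Y))} (hγ : IsOpen γ) {g : Mor (UnitPt Y)}
    (hg : g ∈ γ) : ∃ (s : Hull V) (U : Set (UnitPt Y)), IsOpen U ∧ g ∈ germSet s U ∧
      germSet s U ⊆ γ := by
  induction hγ with
  | basic O hO =>
    obtain ⟨s, U, hU, rfl⟩ := hO
    exact ⟨s, U, hU, hg, subset_rfl⟩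
  | univ =>
    obtain ⟨χ, ψ, f⟩ := g
    obtain ⟨f, rfl⟩ := Quotient.exists_rep f
    exact ⟨f.1, Set.univ, isOpen_univ, ⟨trivial, f.2, rfl⟩, Set.subset_univ _⟩
  | inter O O' _ _ ih ih' =>
    obtain ⟨s, U, hU, hgU, hs⟩ := ih hg.1
    obtain ⟨t, W, hW, hgW, ht⟩ := ih' hg.2
    obtain ⟨hgU, h1, h2⟩ := hgU
    obtain ⟨hgW, h3, h4⟩ := hgW
    obtain ⟨e, he, hst⟩ := Quotient.exact (h2.symm.trans h4)
    refine ⟨s, U ∩ W ∩ {χ | χ.val.1 e = true}, (hU.inter hW).inter (isOpen_setOf_eq_true e),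
      ⟨⟨⟨hgU, hgW⟩, he⟩, h1, h2⟩, ?_⟩
    rintro k ⟨⟨⟨hkU, hkW⟩, hke⟩, h5, h6⟩
    refine ⟨hs ⟨hkU, h5, h6⟩, ht ⟨hkW, ?_, h6.trans (Quotient.sound ⟨e, hke, hst⟩)⟩⟩
    obtain ⟨h7, h8⟩ := h5
    obtain ⟨h9, h10⟩ := act_congr hke hst h7
    exact ⟨h9, h10.symm.trans h8⟩
  | sUnion O _ ih =>
    obtain ⟨o, ho, hgo⟩ := hg
    obtain ⟨s, U, hU, hgU, hs⟩ := ih o ho hgo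
    exact ⟨s, U, hU, hgU, hs.trans (Set.subset_sUnion_of_mem ho)⟩

/-- Topological freeness follows once every `s` which fixes all points of a non-empty open set
restricts to the identity near one of these points. -/
theorem topologicallyFree_of_forall_exists (hY : Invariant Y)
    (H : ∀ (s : Hull V) (U : Set (UnitPt Y)), IsOpen U → U.Nonempty →
      (∀ ψ ∈ U, ∃ h : ψ.val.1 s.supp = true, act s ψ.val h = ψ.val) →
      ∃ ψ ∈ U, ∃ e : Idem V, ψ.val.1 e = true ∧ ∀ x ∈ e.1, s.1 x = some x) :
    TopologicallyFree (UnitPt Y) := by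
  intro γ hγ hdom _ hunit
  by_contra hne
  obtain ⟨χ, hχ⟩ := Set.nonempty_iff_ne_empty.2 hne
  obtain ⟨g, hg, rfl, -⟩ := interior_subset hχ
  obtain ⟨s, U, hU, hgU, hs⟩ := exists_germSet_subset hγ hg
  set W := interior {x : UnitPt Y | ∃ g ∈ γ, g.dom = x ∧ g.cod = x}
  obtain ⟨ψ, ⟨⟨hψU, hψs⟩, -⟩, e, hψe, he⟩ :=
    H s (U ∩ {ψ | ψ.val.1 s.supp = true} ∩ W)
      ((hU.inter (isOpen_setOf_eq_true _)).inter isOpen_interior)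
      ⟨_, ⟨hgU.1, hgU.2.choose.choose⟩, hχ⟩ (by
        rintro ψ ⟨⟨hψU, hψs⟩, hψ⟩
        obtain ⟨k, hk, rfl, hkc⟩ := interior_subset hψ
        refine ⟨hψs, ?_⟩
        -- by injectivity of the source map on `γ`, the element `[s, ψ]` is the given loop at `ψ`
        let ω : UnitPt Y := ⟨act s k.dom.val hψs, hY _ k.dom.mem s hψs⟩
        let k' : Mor (UnitPt Y) :=
          ⟨k.dom, ω, (Quotient.mk _ ⟨s, hψs, rfl⟩ : Germ k.dom ω)⟩
        have hk' : k' ∈ γ := hs ⟨hψU, ⟨hψs, rfl⟩, rfl⟩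
        have h1 : k' = k := hdom hk' hk rfl
        have h2 : ω = k.cod := congrArg Mor.cod h1
        exact congrArg UnitPt.val (h2.trans hkc))
  have hid := (exists_supp ψ.val).choose_spec
  set r := (exists_supp ψ.val).choose
  have hagree : ∀ x ∈ (e.inter r.supp).1, (r.inv.mul r).1 x = s.1 x := fun x hx =>
    (inv_mul_self_apply r hx.2).trans (he x hx.1).symm
  have hψe' : ψ.val.1 (e.inter r.supp) = true := by
    rw [ψ.val.2.1.mul, hψe, hid]
    rfl
  have hid' := hid
  rw [← supp_inv_mul_self] at hid'
  obtain ⟨h1, h2⟩ := act_congr hψe' hagree hid'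
  rw [act_inv_mul_self r ψ.val hid hid'] at h2
  exact hunit ψ (hs ⟨hψU, ⟨h1, h2.symm⟩, Quotient.sound ⟨e.inter r.supp, hψe', hagree⟩⟩)

end TransformationGroupoid

/-! ### Separation of paths -/

section Separation

open Mor

variable {V : Type u} [Category.{v} V] [LeftCancellative V] {S : Set (Mor V)}

/-- For two infinite normal words which agree on sufficiently many initial letters, the characters
agree on the finite set `F`, since elements of `F` are finite unions of ideals `q C`, and whether
`q` divides an infinite normal word is decided by the first letters. -/
theorem exists_forall_eq_of_agree (hS : IsGarside S) (halign : FinitelyAligned V)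
    {w : ℕ → Mor V} {χ : Omega V} (hχ : IsCharOfRun χ (one (w 0).cod) w) (F : Finset (Idem V)) :
    ∃ N, ∀ (w' : ℕ → Mor V) (ψ : Omega V), IsInfiniteNormalWord S w' →
      IsCharOfRun ψ (one (w 0).cod) w' → (w' 0).cod = (w 0).cod → (∀ k < N, w' k = w k) →
      ∀ e ∈ F, ψ.1 e = χ.1 e := by
  -- one element of `J` at a time
  have single : ∀ e : Idem V, ∃ N, ∀ (w' : ℕ → Mor V) (ψ : Omega V), IsInfiniteNormalWord S w' →
      IsCharOfRun ψ (one (w 0).cod) w' → (w' 0).cod = (w 0).cod → (∀ k < N, w' k = w k) →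
      ψ.1 e = χ.1 e := by
    intro e
    cases he : χ.1 e with
    | true =>
      obtain ⟨n, hn⟩ := (hχ e).1 he
      refine ⟨n, fun w' ψ _ hψ _ hag => (hψ e).2 ⟨n, ?_⟩⟩
      rwa [run_congr _ hag]
    | false =>
      obtain ⟨Q, hQ, hQe⟩ := e.finGen halign
      choose L hL using hS.exists_isProd
      obtain ⟨N, hN⟩ := (hQ.image L).bddAbove
      refine ⟨N, fun w' ψ hw' hψ hcod hag => ?_⟩
      by_contra hne
      obtain ⟨m, hm⟩ := (hψ e).1 (by simpa using hne)
      obtain ⟨q, hq, hqm⟩ := (hQe _).1 hm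
      have hqN : L q ≤ N := hN ⟨q, hq, rfl⟩
      have h1 : q.LeftDvd (run (one (w 0).cod) w' N) := by
        refine LeftDvd.trans ?_ (run_leftDvd_run _ _ hqN)
        refine (hL q).leftDvd_run hS hw' (m := max m N) (b := one (w' (max m N)).cod) hcod.symm rfl
          ?_ (hqN.trans (le_max_right _ _)) ?_
        · intro k hk
          rw [hk, ← hw'.isPath k, comp_one]
          exact isHead_self (hw' k).1
        · rw [← dom_run hw'.isPath (y := one (w 0).cod) hcod.symm, comp_one]
          exact hqm.trans (run_leftDvd_run _ _ (le_max_left _ _))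
      rw [run_congr _ hag] at h1
      have h2 : χ.1 e = true := (hχ e).2 ⟨N, (hQe _).2 ⟨q, hq, h1⟩⟩
      rw [he] at h2
      cases h2
  choose N hN using single
  refine ⟨F.sup N, fun w' ψ hw' hψ hcod hag e he => hN e w' ψ hw' hψ hcod fun k hk => ?_⟩
  exact hag k (hk.trans_le (Finset.le_sup he))

/-- Finite normal paths `a, b` with the same ends and different first letters can be told apart by
means of letters in `A`: every `s ∈ A` with the domain of `a` and `b` can be continued to a normal
word `s t` with `t ∈ A` and `H(a t) ≠ H(b t)`. -/
def SeparatesPaths (S A : Set (Mor V)) : Prop :=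
  ∀ (la lb : List (Mor V)) (wa wb a b : Mor V),
    IsFiniteNormalPath S la wa a → IsFiniteNormalPath S lb wb b →
    a.cod = b.cod → a.dom = b.dom → la.headD wa ≠ lb.headD wb →
    ∀ s ∈ A, s.dom = a.dom →
      ∃ t ∈ A, NormalPair S s t ∧
        ∃ (hat : a.dom = t.cod) (hbt : b.dom = t.cod) (p q : Mor V),
          IsHead S (a.mul t hat) p ∧ IsHead S (b.mul t hbt) q ∧ p ≠ q

/-- The separation condition can be iterated, since the products `a t` and `b t` again have
different first letters. This gives an infinite normal word. -/
theorem SeparatesPaths.exists_infinite {A : Set (Mor V)} (hsep : SeparatesPaths S A)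
    (hS : IsGarside S) (hSinv : ∀ s ∈ S, ¬ s.IsInv) (hSbdd : LocallyBounded S)
    (hStrans : Transverse S) (hAS : A ⊆ S) {la lb : List (Mor V)} {wa wb a b s : Mor V}
    (ha : IsFiniteNormalPath S la wa a) (hb : IsFiniteNormalPath S lb wb b)
    (hcod : a.cod = b.cod) (hdom : a.dom = b.dom) (hne : la.headD wa ≠ lb.headD wb) (hs : s ∈ A)
    (hsa : s.dom = a.dom) :
    ∃ t : ℕ → Mor V, IsInfiniteNormalWord S t ∧ (∀ n, t n ∈ A) ∧ NormalPair S s (t 0) ∧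
      ∃ p q : Mor V, IsHead S (a * t 0) p ∧ IsHead S (b * t 0) q ∧ p ≠ q := by
  let P : Mor V → Prop := fun t => t ∈ A ∧ ∃ a b p q : Mor V, ¬ a.IsInv ∧ ¬ b.IsInv ∧
    a.cod = b.cod ∧ a.dom = b.dom ∧ t.dom = a.dom ∧ IsHead S a p ∧ IsHead S b q ∧ p ≠ q
  have hP : ∀ {a b t p q : Mor V}, t ∈ A → a.cod = b.cod → a.dom = t.cod → b.dom = t.cod →
      IsHead S (a * t) p → IsHead S (b * t) q → p ≠ q → P t := by
    intro a b t p q ht hab hat hbt hp hq hpq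
    exact ⟨ht, a * t, b * t, p, q, fun h => hSinv _ (hAS ht) (h.of_mul_right hat),
      fun h => hSinv _ (hAS ht) (h.of_mul_right hbt), by simpa using hab,
      by rw [dom_mul hat, dom_mul hbt], (dom_mul hat).symm, hp, hq, hpq⟩
  have step : ∀ t : {t // P t}, ∃ t' : {t // P t}, NormalPair S t.1 t'.1 := by
    rintro ⟨t, ht, a, b, p, q, ha, hb, hcod, hdom, hta, hp, hq, hpq⟩
    obtain ⟨la, wa, hla⟩ := exists_isFiniteNormalPath hS hSbdd a
    obtain ⟨lb, wb, hlb⟩ := exists_isFiniteNormalPath hS hSbdd b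
    have h1 := (hla.isHead_headD hS ha).unique hStrans hp
    have h2 := (hlb.isHead_headD hS hb).unique hStrans hq
    obtain ⟨t', ht', hn, hat, hbt, p', q', hp', hq', hpq'⟩ :=
      hsep la lb wa wb a b hla hlb hcod hdom (by rwa [h1, h2]) t ht hta
    rw [mul_eq] at hp' hq'
    exact ⟨⟨t', hP ht' hcod hat hbt hp' hq' hpq'⟩, hn⟩
  choose f hf using step
  obtain ⟨t, ht, hn, hat, hbt, p, q, hp, hq, hpq⟩ :=
    hsep la lb wa wb a b ha hb hcod hdom hne s hs hsa
  rw [mul_eq] at hp hq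
  refine ⟨fun n => (f^[n] ⟨t, hP ht hcod hat hbt hp hq hpq⟩).1, fun n => ⟨?_, ?_⟩,
    fun n => (f^[n] _).2.1, hn, p, q, hp, hq, hpq⟩
  · exact hAS (f^[n] _).2.1
  · simp only [Function.iterate_succ_apply']
    exact hf _

/-- If the paths `a t₀ t₁ ⋯` and `b t₀ t₁ ⋯` define the same character after multiplication by `r`
from the left, then `H(a t₀)` divides `H(b t₀)`. -/
theorem IsCharOfRun.leftDvd_of_isHead (hS : IsGarside S) {t : ℕ → Mor V}
    (ht : IsInfiniteNormalWord S t) {r a b p q : Mor V} (hra : r.dom = a.cod)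
    (hrb : r.dom = b.cod) (ha : a.dom = (t 0).cod) (hb : b.dom = (t 0).cod) {χ : Omega V}
    (hχa : IsCharOfRun χ (r * a) t) (hχb : IsCharOfRun χ (r * b) t)
    (hp : IsHead S (a * t 0) p) (hq : IsHead S (b * t 0) q) : p.LeftDvd q := by
  have hrp : r.dom = p.cod := by rw [hp.2.1.cod_eq, cod_mul, hra]
  have h1 : χ.1 (Idem.principal (r * p)) = true := by
    refine (hχa _).2 ⟨1, ?_⟩
    change (r * p).LeftDvd (r * a * t 0)
    rw [comp_assoc hra ha]
    exact hp.2.1.mul_left hrp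
  obtain ⟨k, hk⟩ := (hχb _).1 h1
  have hk : (r * p).LeftDvd (run (r * b) t k) := hk
  rw [← mul_run ht.isPath hb hrb] at hk
  exact hq.2.2 p hp.1
    (leftDvd_of_leftDvd_run hS ht hb hp.1 (hk.of_mul_left hrp (by simpa using hrb)))

end Separation

/-! ### Elements of the hull which fix an open set of characters -/

section FixedPoints

open Mor

variable {V : Type u} [Category.{v} V] [LeftCancellative V] {S T₁ T₂ : Set (Mor V)}
  {D₁ D₂ : Set V}

theorem apply_eq_self_of_leftDvd {s : Hull V} {p x : Mor V} (hp : p ∈ s.1 p)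
    (hx : p.LeftDvd x) : s.1 x = some x := by
  obtain ⟨z, hz, rfl⟩ := leftDvd_iff.1 hx
  exact (s.2.equivariant hp).2 z hz

/-- If `s` fixes the characters near that of an infinite word `w`, then it maps a sufficiently long
initial piece `p` of `w` to itself: otherwise the separation condition yields an infinite normal
word `w'` which starts with `p`, has its character in the given neighbourhood, and is moved by
`s`. -/
theorem exists_identity_of_infinite (hS : IsGarside S) (halign : FinitelyAligned V)
    (hSinv : ∀ s ∈ S, ¬ s.IsInv) (hStrans : Transverse S) (hSbdd : LocallyBounded S)
    (hT₂S : T₂ ⊆ S) (hinv₁ : HInvariant S T₁ D₁) (hsep : SeparatesPaths S (T₂ \ T₁)) {s : Hull V}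
    {U : Set (UnitPt (spaceOf S T₂ D₂ \ spaceOf S T₁ D₁))} (hU : IsOpen U)
    (hfix : ∀ ψ ∈ U, ∃ h : ψ.val.1 s.supp = true, act s ψ.val h = ψ.val)
    {χ : UnitPt (spaceOf S T₂ D₂ \ spaceOf S T₁ D₁)} (hχU : χ ∈ U) {w : ℕ → Mor V}
    (hw : IsInfiniteNormalWord S w) (hwT : ∀ n, w n ∈ T₂) (hχ : IsCharOfInfinite χ.val w) :
    ∃ e : Idem V, χ.val.1 e = true ∧ ∀ x ∈ e.1, s.1 x = some x := by
  obtain ⟨k, hk⟩ : ∃ k, w k ∉ T₁ := by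
    by_contra! h
    exact χ.mem.2 (.inl ⟨w, hw, h, hχ⟩)
  have hk' : ∀ n, k ≤ n → w n ∉ T₁ := by
    intro n hn
    induction n, hn using Nat.le_induction with
    | base => exact hk
    | succ n _ ih =>
      exact fun h => ih (hinv₁.mem_of_normalPair hSinv hStrans (hw n).1 h (hw n).2)
  rw [isCharOfInfinite_iff hw.isPath] at hχ
  obtain ⟨hs, hsχ⟩ := hfix χ hχU
  obtain ⟨n₀, hn₀⟩ := (hχ _).1 hs
  obtain ⟨F, hF⟩ := exists_finset_of_isOpen hU hχU
  obtain ⟨N, hN⟩ := exists_forall_eq_of_agree hS halign hχ F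
  obtain ⟨n, hkn, hn₀n, hNn⟩ : ∃ n, k ≤ n ∧ n₀ ≤ n ∧ N ≤ n :=
    ⟨max k (max n₀ N), le_max_left _ _, (le_max_left _ _).trans (le_max_right _ _),
      (le_max_right _ _).trans (le_max_right _ _)⟩
  obtain ⟨p, hpdef⟩ : ∃ p, p = run (one (w 0).cod) w (n + 1) := ⟨_, rfl⟩
  have hpd : p.dom = (w (n + 1)).cod := hpdef ▸ dom_run hw.isPath rfl (n + 1)
  have hpn : p.dom = (w n).dom := hpd.trans (hw.isPath n).symm
  obtain ⟨q, hq⟩ : p ∈ s.supp.1 :=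
    hpdef ▸ s.supp.mem_of_leftDvd hn₀ (run_leftDvd_run _ _ (by omega))
  have hχp : IsCharOfRun χ.val p fun k => w (n + 1 + k) := hpdef ▸ hχ.shift (n + 1)
  have hpp : χ.val.1 (Idem.principal p) = true := (hχp _).2 ⟨0, LeftDvd.refl p⟩
  by_cases hpq : p = q
  · rw [← hpq] at hq
    exact ⟨Idem.principal p, hpp, fun x hx => apply_eq_self_of_leftDvd hq hx⟩
  exfalso
  have hdom : p.dom = q.dom := (s.2.equivariant hq).1
  have hcod : p.cod = q.cod := by
    have h1 := isCharOfRun_act hs hq (hw.shift (n + 1)).isPath hpd hχp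
    rw [hsχ] at h1
    obtain ⟨j, hj⟩ := (h1 _).1 hpp
    simpa using LeftDvd.cod_eq hj
  obtain ⟨la, wa, hla⟩ := exists_isFiniteNormalPath hS hSbdd p
  obtain ⟨lb, wb, hlb⟩ := exists_isFiniteNormalPath hS hSbdd q
  obtain ⟨r, a, b, la', lb', hra, hrb, rfl, rfl, hla', hlb', hne⟩ :=
    exists_common_prefix hSinv hla hlb hpq hcod
  rw [dom_mul hra] at hpd hpn hdom
  rw [dom_mul hrb] at hdom
  obtain ⟨t, ht, htT, hwt, h, h', hh, hh', hhh'⟩ := hsep.exists_infinite hS hSinv hSbdd hStrans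
    (fun t ht => hT₂S ht.1) hla' hlb' (hra.symm.trans hrb) hdom hne ⟨hwT n, hk' n hkn⟩ hpn.symm
  have hat : a.dom = (t 0).cod := hpn.trans hwt.dom_eq
  obtain ⟨w', hw'def⟩ : ∃ w' : ℕ → Mor V,
    w' = fun k => if k ≤ n then w k else t (k - (n + 1)) := ⟨_, rfl⟩
  have hw'w : ∀ k ≤ n, w' k = w k := fun k hk => by rw [hw'def]; exact if_pos hk
  have hw't : ∀ k, w' (n + 1 + k) = t k := fun k => by
    rw [hw'def]
    simp only [show ¬ n + 1 + k ≤ n by omega, if_false, Nat.add_sub_cancel_left]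
  have hw't' : ∀ k, n < k → ∃ j, k = n + 1 + j := fun k hk => ⟨k - (n + 1), by omega⟩
  have hw' : IsInfiniteNormalWord S w' := by
    intro k
    rcases lt_trichotomy k n with hkn | rfl | hkn
    · rw [hw'w k hkn.le, hw'w (k + 1) hkn]
      exact hw k
    · rw [hw'w k le_rfl, ← add_zero (k + 1), hw't 0]
      exact ⟨(hw k).1, hwt⟩
    · obtain ⟨j, rfl⟩ := hw't' k hkn
      rw [add_assoc (n + 1) j 1, hw't, hw't]
      exact ht j
  have hw'T : ∀ k, w' k ∈ T₂ := by
    intro k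
    rcases le_or_gt k n with hkn | hkn
    · rw [hw'w k hkn]
      exact hwT k
    · obtain ⟨j, rfl⟩ := hw't' k hkn
      rw [hw't]
      exact (htT j).1
  have hw'0 : w' 0 = w 0 := hw'w 0 (Nat.zero_le n)
  obtain ⟨ψ, hψ⟩ := exists_isCharOfRun (one (w 0).cod) w'
  have hψ' : IsCharOfRun ψ (one (w' 0).cod) w' := by rwa [hw'0]
  have hψY : ψ ∈ spaceOf S T₂ D₂ \ spaceOf S T₁ D₁ := by
    refine ⟨.inl ⟨w', hw', hw'T, (isCharOfInfinite_iff hw'.isPath).2 hψ'⟩, ?_⟩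
    refine notMem_spaceOf_of_isCharOfRun hS hSinv hStrans hw' (n := n) ?_ hψ'
    rw [hw'w n le_rfl]
    exact hk' n hkn
  obtain ⟨hsψ, hψfix⟩ := hfix ⟨ψ, hψY⟩ (hF _ (hN w' ψ hw' hψ (by rw [hw'0])
    fun k hk => hw'w k (by omega)))
  have hψa : IsCharOfRun ψ (r * a) t := by
    have h1 := hψ.shift (n + 1)
    simp only [hw't] at h1
    rwa [run_congr _ fun k hk => hw'w k (by omega), ← hpdef] at h1
  have hψb : IsCharOfRun ψ (r * b) t := by
    have h1 := isCharOfRun_act hsψ hq ht.isPath ((dom_mul hra).trans hat) hψa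
    rwa [hψfix] at h1
  have hbt : b.dom = (t 0).cod := hdom.symm.trans hat
  exact hhh' (hStrans h hh.1 h' hh'.1
    ((hψa.leftDvd_of_isHead hS ht hra hrb hat hbt hψb hh hh').antisymm
      (hψb.leftDvd_of_isHead hS ht hrb hra hbt hat hψa hh' hh)))

/-- If `s` fixes the character of an element `a`, then `s(a) = a u` for some invertible `u`, and
`u` is trivial if the only invertible loop at the domain of `a` is the identity. -/
theorem exists_identity_of_isCharOf {s : Hull V} {χ : Omega V} (hs : χ.1 s.supp = true)
    (hsχ : act s χ hs = χ) {a : Mor V} (hχ : IsCharOf χ a)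
    (hloop : ∀ w : a.dom ⟶ a.dom, IsIso w → w = 𝟙 a.dom) :
    ∃ e : Idem V, χ.1 e = true ∧ ∀ x ∈ e.1, s.1 x = some x := by
  obtain ⟨b, hb, hχb⟩ := isCharOf_act hs hχ
  rw [hsχ] at hχb
  rw [isCharOf_iff] at hχ hχb
  have haa : χ.1 (Idem.principal a) = true := (hχ _).2 (LeftDvd.refl a)
  have hab : a.LeftDvd b := (hχb _).1 haa
  have hba : b.LeftDvd a := (hχ (Idem.principal b)).1 ((hχb _).2 (LeftDvd.refl b))
  obtain ⟨⟨x, y, f⟩, hu, hinv, rfl⟩ := unitEq_iff.1 (hba.antisymm hab)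
  have hx : a.dom = x := by rw [(s.2.equivariant hb).1, dom_mul hu]
  have hy : a.dom = y := hu
  subst hx
  subst hy
  obtain rfl : f = 𝟙 _ := hloop f hinv
  have h1 : a * one a.dom ∈ s.1 a := hb
  rw [comp_one] at h1
  exact ⟨Idem.principal a, haa, fun x hx => apply_eq_self_of_leftDvd h1 hx⟩

end FixedPoints

end GarsideCat

theorem mainTheorem12 {V : Type u} [Category.{v} V] [GarsideCat.LeftCancellative V]
    -- the category is countable and finitely aligned
    (hcount : Countable (GarsideCat.Mor V)) (halign : GarsideCat.FinitelyAligned V)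
    -- `S` is a Garside family as in the standing assumptions
    (S : Set (GarsideCat.Mor V)) (hS : GarsideCat.IsGarside S) (hSinv : ∀ s ∈ S, ¬ s.IsInv)
    (hStrans : GarsideCat.Transverse S) (hSbdd : GarsideCat.LocallyBounded S)
    -- the two nested pairs
    (T₁ T₂ : Set (GarsideCat.Mor V)) (D₁ D₂ : Set V) (hT₁S : T₁ ⊆ S) (hT₂S : T₂ ⊆ S)
    (hadm₁ : GarsideCat.Admissible S T₁ D₁) (hadm₂ : GarsideCat.Admissible S T₂ D₂)
    (hinv₁ : GarsideCat.HInvariant S T₁ D₁) (hinv₂ : GarsideCat.HInvariant S T₂ D₂)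
    (hmax₁ : GarsideCat.MaxClosed S T₁ D₁) (hmax₂ : GarsideCat.MaxClosed S T₂ D₂)
    (hiso₁ : GarsideCat.IsoClosed D₁) (hiso₂ : GarsideCat.IsoClosed D₂)
    (hT : T₁ ⊆ T₂) (hD : D₁ ⊆ D₂)
    -- objects in `D₂ \ D₁` have trivial invertible loops
    (hloop : ∀ x ∈ D₂ \ D₁, ∀ w : x ⟶ x, IsIso w → w = 𝟙 x)
    -- finite normal paths with the same ends and different first letters can be told apart
    (hsep : ∀ (la lb : List (GarsideCat.Mor V)) (wa wb a b : GarsideCat.Mor V),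
      GarsideCat.IsFiniteNormalPath S la wa a → GarsideCat.IsFiniteNormalPath S lb wb b →
      a.cod = b.cod → a.dom = b.dom → la.headD wa ≠ lb.headD wb →
      ∀ s ∈ T₂ \ T₁, s.dom = a.dom →
        ∃ t ∈ T₂ \ T₁, GarsideCat.NormalPair S s t ∧
          ∃ (hat : a.dom = t.cod) (hbt : b.dom = t.cod) (p q : GarsideCat.Mor V),
            GarsideCat.IsHead S (a.mul t hat) p ∧ GarsideCat.IsHead S (b.mul t hbt) q ∧ p ≠ q) :
    GarsideCat.Invariant (GarsideCat.spaceOf S T₂ D₂ \ GarsideCat.spaceOf S T₁ D₁) ∧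
      GarsideCat.TopologicallyFree
        (GarsideCat.UnitPt (GarsideCat.spaceOf S T₂ D₂ \ GarsideCat.spaceOf S T₁ D₁)) := by
  have hinv := (GarsideCat.invariant_spaceOf hS hSinv hStrans hSbdd hinv₂ hiso₂).diff
    (GarsideCat.invariant_spaceOf hS hSinv hStrans hSbdd hinv₁ hiso₁)
  refine ⟨hinv, GarsideCat.topologicallyFree_of_forall_exists hinv
    fun s U hU ⟨χ, hχU⟩ hfix => ⟨χ, hχU, ?_⟩⟩
  obtain ⟨w, hw, hwT, hχ⟩ | ⟨l, x, a, hx, hl, hlT, ha, hχ⟩ := χ.mem.1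
  · exact GarsideCat.exists_identity_of_infinite hS halign hSinv hStrans hSbdd hT₂S hinv₁
      hsep hU hfix hχU hw hwT hχ
  · obtain ⟨hs, hsχ⟩ := hfix χ hχU
    obtain rfl : a.dom = x := ha.dom_eq
    exact GarsideCat.exists_identity_of_isCharOf hs hsχ hχ (hloop _ ⟨hx, fun hx₁ => χ.mem.2
      (GarsideCat.mem_spaceOf_of_isCharOf hS hSinv hStrans hSbdd hinv₁ hiso₁ hx₁ hχ)⟩)
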